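/- Smoothness is in the sense of Bastiani: a continuous map $f\colon E\supseteq U\to F$ on an open subset of a Hausdorff locally convex space is $C^{n}$, $n\ge 1$, if all directional derivatives $df(x;v)=\lim_{t\to0}t^{-1}(f(x+tv)-f(x))$ exist and $df\colon U\times E\to F$ is $C^{n-1}$; it is smooth if it is $C^n$ for all $n$. Let $M$ be a smooth manifold modelled on a real Hausdorff locally convex space $E$, and let $g$ be a weak Riemannian metric on $M$, i.e. a smooth map $g\colon TM\oplus TM\to\mathbb R$ whose restriction $g_p$ to each $T_pM$ is an inner product (it need not induce the topology of $T_pM$). In a chart with domain $U$ write $g_U(x,v,w)$ for the local representative of $g$ and $d_1$ for the derivative in the first variable. A covariant derivative $\nabla$ on $M$ is a family of operators $\nabla\colon\mathcal V(U)\times\mathcal V(U)\to\mathcal V(U)$, $U\subseteq M$ open, compatible with restriction to smaller open sets, additive in both arguments, with $\nabla_{fX}Y=f\nabla_XY$ and $\nabla_X(fY)=(X.f)Y+f\nabla_XY$ for $f\in C^\infty(U,\mathbb R)$. It is a metric derivative (Levi-Civita derivative) of $g$ if in addition $\nabla_XY-\nabla_YX=[X,Y]$ and $X.g(Y,Z)=g(\nabla_XY,Z)+g(Y,\nabla_XZ)$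 for all smooth vector fields $X,Y,Z$ on open sets; if $E$ is not a Fréchet space, it is also required to take smooth families of vector fields (with parameter in $E$) to smooth families. The metric $g$ is called robust if (1) the Hilbert space completions $\overline{T_xM}^{g_x}$ of the tangent spaces form a smooth vector bundle $\overline{TM}=\bigcup_{x\in M}\overline{T_xM}^{g_x}$ over $M$ whose trivialisations extend bundle trivialisations of $TM$; that is, around every point of $M$ there are an open set $W$, a smooth bundle trivialisation $\theta\colon TW\to W\times E$, a Hilbert space $H$, a continuous linear map $j\colon E\to H$ and isomorphisms of topological vector spaces $\bar\theta_x\colon\overline{T_xM}^{g_x}\to H$, $x\in W$, with $\bar\theta_x|_{T_xM}=j\circ\theta_x$, such that for any two of these the changes of trivialisation $(x,h)\mapsto\bar\theta'_x\bar\theta_x^{-1}h$ are smooth on $(W\cap W')\times H$; and (2) a metric derivative of $g$ exists. A spray on $M$ is a smooth vector field $S\colon TM\to T(TM)$ with $T\pi_M\circ S=\mathrm{id}_{TM}$ and $S\circ h_\lambda=Th_\lambda(\lambda S)$ for all $\lambda\in\mathbb R$, where $h_\lambda\colon TM\to TM$ is multiplication by $\lambda$ in the fibres; in a chart it has the form $S_U(x,v)=(x,v,v,\Gamma_U(x,v))$.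 It is a metric spray of $g$ if in every chart $$g_U(x,\Gamma_U(x,v),w)=\tfrac12\,d_1g_U(x,v,v;w)-d_1g_U(x,v,w;v)$$ for all $x$, $v$, $w$. The pair $(M,g)$ is a Hesse manifold if $g$ admits a metric spray. **Proposition.** If $g$ is a robust Riemannian metric on $M$, then $(M,g)$ is a Hesse manifold. -/

import Mathlib

open Set Filter Topology TopologicalSpace

universe u v w

noncomputable section

/-! ### Bastiani calculus on locally convex spaces -/

section Calculus

variable {E : Type u} [AddCommGroup E] [Module ℝ E] [TopologicalSpace E]
  {F : Type v} [AddCommGroup F] [Module ℝ F] [TopologicalSpace F]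

/-- `w` is the directional derivative `df(x; v) = lim_{t → 0} t⁻¹ (f (x + t v) - f x)`. -/
def HasDirDeriv (f : E → F) (x v : E) (w : F) : Prop :=
  Tendsto (fun t : ℝ => t⁻¹ • (f (x + t • v) - f x)) (𝓝[≠] 0) (𝓝 w)

/-- The directional derivative `df(x; v)` (only meaningful where it exists). -/
def dirDeriv (f : E → F) (x v : E) : F :=
  limUnder (𝓝[≠] (0 : ℝ)) (fun t : ℝ => t⁻¹ • (f (x + t • v) - f x))

/-- The tangent map `Tf (x, v) = (f x, df(x; v))` of a map between open subsets of
locally convex spaces. -/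
def tangentFun (f : E → F) (z : E × E) : F × F :=
  (f z.1, dirDeriv f z.1 z.2)

end Calculus

/-- `f` is of class `C^n` in the sense of Bastiani on the (open) set `U`: it is continuous on `U`
and, for `n ≥ 1`, all directional derivatives `df(x; v)`, `x ∈ U`, exist and
`df : U × E → F` is of class `C^(n-1)`. -/
def BastianiCOn : ℕ → ∀ {E : Type u} [AddCommGroup E] [Module ℝ E] [TopologicalSpace E]
    {F : Type v} [AddCommGroup F] [Module ℝ F] [TopologicalSpace F],
    (E → F) → Set E → Prop
  | 0, _, _, _, _, _, _, _, _, f, U => ContinuousOn f U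
  | n + 1, _, _, _, _, _, _, _, _, f, U =>
      ContinuousOn f U ∧ (∀ x ∈ U, ∀ v, ∃ w, HasDirDeriv f x v w) ∧
        BastianiCOn n (fun z => dirDeriv f z.1 z.2) (U ×ˢ univ)

/-- Bastiani smoothness (`C^∞`) on an open set. -/
def BastianiSmoothOn {E : Type u} [AddCommGroup E] [Module ℝ E] [TopologicalSpace E]
    {F : Type v} [AddCommGroup F] [Module ℝ F] [TopologicalSpace F]
    (f : E → F) (U : Set E) : Prop :=
  ∀ n : ℕ, BastianiCOn n f U

/-- A locally convex Hausdorff space is a Fréchet space if it is metrizable (equivalently, first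
countable) and complete. -/
def IsFrechetSpace (E : Type u) [AddCommGroup E] [TopologicalSpace E]
    [IsTopologicalAddGroup E] : Prop :=
  FirstCountableTopology E ∧ @CompleteSpace E (IsTopologicalAddGroup.rightUniformSpace E)

/-! ### Manifolds modelled on a locally convex space, tangent vectors, vector fields -/

/-- A smooth manifold modelled on `E`: all changes of charts are Bastiani smooth. -/
class BastianiManifold (E : Type u) [AddCommGroup E] [Module ℝ E] [TopologicalSpace E]
    (M : Type w) [TopologicalSpace M] [ChartedSpace E M] : Prop where
  smooth_change : ∀ e ∈ atlas E M, ∀ e' ∈ atlas E M,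
    BastianiSmoothOn (fun y => e' (e.symm y)) (e.target ∩ e.symm ⁻¹' e'.source)

/-- The tangent space `T_p M`. As for tangent spaces in Mathlib, a tangent vector at `p` is
stored as its coordinate vector in the preferred chart `chartAt E p`. -/
abbrev TVec (E : Type u) {M : Type w} (_p : M) : Type u := E

section Manifold

variable {E : Type u} [AddCommGroup E] [Module ℝ E] [TopologicalSpace E]
  {M : Type w} [TopologicalSpace M] [ChartedSpace E M]

/-- The coordinates `T_p e (v)` of a tangent vector `v ∈ T_p M` in a chart `e` around `p`. -/
def tcoord (e : OpenPartialHomeomorph M E) (p : M) (v : TVec E p) : E :=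
  dirDeriv (fun y => e ((chartAt E p).symm y)) (chartAt E p p) v

/-- The tangent vector at `e⁻¹ y` whose coordinates in the chart `e` are `v`. -/
def tvec (e : OpenPartialHomeomorph M E) (y : E) (v : E) : TVec E (e.symm y) :=
  dirDeriv (fun z => chartAt E (e.symm y) (e.symm z)) y v

/-- The part of the image of the chart `e` that lies over `U`. -/
def chartImage (e : OpenPartialHomeomorph M E) (U : Opens M) : Set E :=
  e.target ∩ e.symm ⁻¹' (U : Set M)

/-- Smooth real functions on the open set `U` (values outside `U` are irrelevant). -/
def IsSmoothFun (U : Opens M) (f : M → ℝ) : Prop :=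
  ∀ e ∈ atlas E M, BastianiSmoothOn (fun y => f (e.symm y)) (chartImage e U)

/-- The local representative of a vector field in the chart `e`. -/
def localRep (e : OpenPartialHomeomorph M E) (X : ∀ p : M, TVec E p) (y : E) : E :=
  tcoord e (e.symm y) (X (e.symm y))

/-- Smooth vector fields on the open set `U` (values outside `U` are irrelevant). -/
def IsSmoothVF (U : Opens M) (X : ∀ p : M, TVec E p) : Prop :=
  ∀ e ∈ atlas E M, BastianiSmoothOn (localRep e X) (chartImage e U)

/-- Smooth families `(X_s)`, `s ∈ E`, of vector fields on the open set `U`: `(s, p) ↦ X_s p` is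
smooth on `E × U`. -/
def IsSmoothFamily (U : Opens M) (X : E → ∀ p : M, TVec E p) : Prop :=
  ∀ e ∈ atlas E M,
    BastianiSmoothOn (fun z : E × E => localRep e (X z.1) z.2) (univ ×ˢ chartImage e U)

/-- The derivative `(X.f)(p) = D_p f (X p)`. -/
def derivAlong (X : ∀ p : M, TVec E p) (f : M → ℝ) (p : M) : ℝ :=
  dirDeriv (fun y => f ((chartAt E p).symm y)) (chartAt E p p) (X p)

/-- The Lie bracket of vector fields, `[X, Y] = dY(·; X) - dX(·; Y)` in a chart. -/
def lieBracketVF (X Y : ∀ p : M, TVec E p) (p : M) : TVec E p :=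
  dirDeriv (localRep (chartAt E p) Y) (chartAt E p p) (X p) -
    dirDeriv (localRep (chartAt E p) X) (chartAt E p p) (Y p)

end Manifold

/-! ### Covariant derivatives -/

/-- A covariant derivative: an operator on the smooth vector fields over every open subset of the
manifold, compatible with restriction, function-linear in the first argument and a derivation
in the second. The axiom `restrict` also says that values outside `U` are irrelevant. -/
structure CovDeriv (E : Type u) [AddCommGroup E] [Module ℝ E] [TopologicalSpace E]
    (M : Type w) [TopologicalSpace M] [ChartedSpace E M] where
  nabla : Opens M → (∀ p : M, TVec E p) → (∀ p : M, TVec E p) → (∀ p : M, TVec E p)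
  smooth : ∀ U X Y, IsSmoothVF U X → IsSmoothVF U Y → IsSmoothVF U (nabla U X Y)
  restrict : ∀ U V : Opens M, V ≤ U → ∀ X Y X' Y',
    IsSmoothVF U X → IsSmoothVF U Y →
    (∀ p ∈ V, X' p = X p) → (∀ p ∈ V, Y' p = Y p) →
    ∀ p ∈ V, nabla V X' Y' p = nabla U X Y p
  add_left : ∀ U X X' Y, IsSmoothVF U X → IsSmoothVF U X' → IsSmoothVF U Y →
    ∀ p ∈ U, nabla U (fun q => X q + X' q) Y p = nabla U X Y p + nabla U X' Y p
  smul_left : ∀ U (f : M → ℝ) X Y, IsSmoothFun (E := E) U f → IsSmoothVF U X → IsSmoothVF U Y →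
    ∀ p ∈ U, nabla U (fun q => f q • X q) Y p = f p • nabla U X Y p
  add_right : ∀ U X Y Y', IsSmoothVF U X → IsSmoothVF U Y → IsSmoothVF U Y' →
    ∀ p ∈ U, nabla U X (fun q => Y q + Y' q) p = nabla U X Y p + nabla U X Y' p
  leibniz : ∀ U (f : M → ℝ) X Y, IsSmoothFun (E := E) U f → IsSmoothVF U X → IsSmoothVF U Y →
    ∀ p ∈ U, nabla U X (fun q => f q • Y q) p = derivAlong X f p • Y p + f p • nabla U X Y p

section Covariant

variable {E : Type u} [AddCommGroup E] [Module ℝ E] [TopologicalSpace E]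
  {M : Type w} [TopologicalSpace M] [ChartedSpace E M]

/-- Torsion-freeness: `∇_X Y - ∇_Y X = [X, Y]`. -/
def CovDeriv.IsTorsionFree (D : CovDeriv E M) : Prop :=
  ∀ U X Y, IsSmoothVF U X → IsSmoothVF U Y →
    ∀ p ∈ U, D.nabla U X Y p - D.nabla U Y X p = lieBracketVF X Y p

/-- The covariant derivative takes smooth families of vector fields to smooth families. -/
def CovDeriv.PreservesSmoothFamilies (D : CovDeriv E M) : Prop :=
  ∀ U (X Y : E → ∀ p : M, TVec E p), IsSmoothFamily U X → IsSmoothFamily U Y →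
    IsSmoothFamily U (fun s => D.nabla U (X s) (Y s))

end Covariant

/-! ### Weak Riemannian metrics -/

/-- A weak Riemannian metric: a smooth map `g : TM ⊕ TM → ℝ` that restricts to an inner product
on every tangent space. -/
structure WeakRiemannianMetric (E : Type u) [AddCommGroup E] [Module ℝ E] [TopologicalSpace E]
    (M : Type w) [TopologicalSpace M] [ChartedSpace E M] where
  val : ∀ p : M, TVec E p →ₗ[ℝ] TVec E p →ₗ[ℝ] ℝ
  symm : ∀ p v w, val p v w = val p w v
  nonneg : ∀ p v, 0 ≤ val p v v
  definite : ∀ p v, val p v v = 0 → v = 0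
  smooth : ∀ e ∈ atlas E M,
    BastianiSmoothOn
      (fun z : E × E × E => val (e.symm z.1) (tvec e z.1 z.2.1) (tvec e z.1 z.2.2))
      (e.target ×ˢ univ)

section Metric

variable {E : Type u} [AddCommGroup E] [Module ℝ E] [TopologicalSpace E]
  {M : Type w} [TopologicalSpace M] [ChartedSpace E M]

/-- The local representative `g_U(y, v, w)` of the metric in the chart `e`. -/
def WeakRiemannianMetric.localRep (g : WeakRiemannianMetric E M) (e : OpenPartialHomeomorph M E)
    (y v w : E) : ℝ :=
  g.val (e.symm y) (tvec e y v) (tvec e y w)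

/-- Compatibility with the metric: `X.g(Y, Z) = g(∇_X Y, Z) + g(Y, ∇_X Z)`. -/
def WeakRiemannianMetric.IsCompatible (g : WeakRiemannianMetric E M) (D : CovDeriv E M) : Prop :=
  ∀ U X Y Z, IsSmoothVF U X → IsSmoothVF U Y → IsSmoothVF U Z → ∀ p ∈ U,
    derivAlong X (fun q => g.val q (Y q) (Z q)) p =
      g.val p (D.nabla U X Y p) (Z p) + g.val p (Y p) (D.nabla U X Z p)

/-- The metric derivative (Levi-Civita covariant derivative) of `g` exists. If the model space
is not a Fréchet space, the covariant derivative is also required to preserve smooth families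
(for Fréchet spaces this is automatic). -/
def WeakRiemannianMetric.HasMetricDerivative [IsTopologicalAddGroup E]
    (g : WeakRiemannianMetric E M) : Prop :=
  ∃ D : CovDeriv E M, D.IsTorsionFree ∧ g.IsCompatible D ∧
    (IsFrechetSpace E ∨ D.PreservesSmoothFamilies)

/-! ### Hilbert completions of the tangent spaces -/

/-- The tangent space `T_p M`, with the inner product `g_p` and the norm induced by it. -/
def MetricFibre (_g : WeakRiemannianMetric E M) (p : M) : Type u := TVec E p

instance (g : WeakRiemannianMetric E M) (p : M) : AddCommGroup (MetricFibre g p) :=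
  inferInstanceAs (AddCommGroup E)

instance (g : WeakRiemannianMetric E M) (p : M) : Module ℝ (MetricFibre g p) :=
  inferInstanceAs (Module ℝ E)

/-- The inner product `g_p`. -/
@[reducible] def WeakRiemannianMetric.core (g : WeakRiemannianMetric E M) (p : M) :
    InnerProductSpace.Core ℝ (MetricFibre g p) where
  inner v w := g.val p v w
  conj_inner_symm v w := by simpa using g.symm p w v
  re_inner_nonneg v := by simpa using g.nonneg p v
  add_left v v' w := by
    exact LinearMap.congr_fun ((g.val p).map_add v v') w
  smul_left v w r := by
    exact LinearMap.congr_fun ((g.val p).map_smul r v) w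
  definite v h := g.definite p v h

instance (g : WeakRiemannianMetric E M) (p : M) : NormedAddCommGroup (MetricFibre g p) :=
  (g.core p).toNormedAddCommGroup

instance (g : WeakRiemannianMetric E M) (p : M) : InnerProductSpace ℝ (MetricFibre g p) :=
  InnerProductSpace.ofCore (g.core p).toCore

/-- The Hilbert space completion of `T_p M` with respect to `g_p`. -/
abbrev HilbertFibre (g : WeakRiemannianMetric E M) (p : M) : Type u :=
  UniformSpace.Completion (MetricFibre g p)

/-- The inclusion of `T_p M` in its Hilbert space completion. -/
def toHilbertFibre (g : WeakRiemannianMetric E M) (p : M) (v : TVec E p) : HilbertFibre g p :=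
  UniformSpace.Completion.coe' (show MetricFibre g p from v)

end Metric

/-- A smooth bundle trivialisation `TW ≅ W × E` of the tangent bundle over an open set `W`
(values outside `W` are irrelevant). -/
structure TangentTriv (E : Type u) [AddCommGroup E] [Module ℝ E] [TopologicalSpace E]
    (M : Type w) [TopologicalSpace M] [ChartedSpace E M] where
  W : Opens M
  triv : ∀ p : M, TVec E p ≃ₗ[ℝ] E
  smooth_triv : ∀ e ∈ atlas E M,
    BastianiSmoothOn (fun z : E × E => triv (e.symm z.1) (tvec e z.1 z.2))
      (chartImage e W ×ˢ univ)
  smooth_symm : ∀ e ∈ atlas E M,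
    BastianiSmoothOn (fun z : E × E => tcoord e (e.symm z.1) ((triv (e.symm z.1)).symm z.2))
      (chartImage e W ×ˢ univ)

/-- A local trivialisation of the union of the Hilbert completions of the tangent spaces, with
fibre a Hilbert space `H`, that extends a trivialisation `TW ≅ W × E` of the tangent bundle along
a continuous linear map `j : E → H` (values outside `W` are irrelevant). -/
structure CompletedTriv {E : Type u} [AddCommGroup E] [Module ℝ E] [TopologicalSpace E]
    {M : Type w} [TopologicalSpace M] [ChartedSpace E M] (g : WeakRiemannianMetric E M)
    extends TangentTriv E M where
  H : Type u
  [normed : NormedAddCommGroup H]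
  [inner : InnerProductSpace ℝ H]
  [complete : CompleteSpace H]
  j : E →L[ℝ] H
  ext : ∀ p : M, HilbertFibre g p →L[ℝ] H
  extSymm : ∀ p : M, H →L[ℝ] HilbertFibre g p
  left_inv : ∀ p ∈ W, ∀ x, extSymm p (ext p x) = x
  right_inv : ∀ p ∈ W, ∀ h, ext p (extSymm p h) = h
  ext_coe : ∀ p ∈ W, ∀ v : TVec E p, ext p (toHilbertFibre g p v) = j (triv p v)

attribute [instance] CompletedTriv.normed CompletedTriv.inner CompletedTriv.complete

/-! ### Sprays -/

/-- A spray: a smooth vector field `S` on `TM` with `Tπ ∘ S = id` and `S ∘ h_c = T h_c (c S)` for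
all real `c`, where `h_c` is multiplication by `c` in the fibres of `TM`.

As for `TVec`, the element `S p v` of the tangent space of `TM` at `(p, v)` is stored in the
coordinates of the chart of `TM` that belongs to the preferred chart of `M` at `p`; in these
coordinates `Tπ (a, b) = a` and `T h_c (a, b) = (a, c b)`. -/
structure Spray (E : Type u) [AddCommGroup E] [Module ℝ E] [TopologicalSpace E]
    (M : Type w) [TopologicalSpace M] [ChartedSpace E M] where
  toFun : ∀ p : M, TVec E p → E × E
  smooth : ∀ e ∈ atlas E M,
    BastianiSmoothOn
      (fun z : E × E =>
        dirDeriv (tangentFun fun y => e ((chartAt E (e.symm z.1)).symm y))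
          (chartAt E (e.symm z.1) (e.symm z.1), tvec e z.1 z.2)
          (toFun (e.symm z.1) (tvec e z.1 z.2)))
      (e.target ×ˢ univ)
  proj : ∀ p v, (toFun p v).1 = v
  homogeneous : ∀ (c : ℝ) p v,
    toFun p (c • v) = ((c • toFun p v).1, c • (c • toFun p v).2)

section Hesse

variable {E : Type u} [AddCommGroup E] [Module ℝ E] [TopologicalSpace E]
  {M : Type w} [TopologicalSpace M] [ChartedSpace E M]

/-- The principal part of the local representative of a spray in the chart `e`: the second tangent
map of the change of charts is applied to the value of `S` at the tangent vector with
base point coordinates `y` and coordinates `v`. The result is `(v, Γ_U(y, v))`. -/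
def Spray.localRep (S : Spray E M) (e : OpenPartialHomeomorph M E) (y v : E) : E × E :=
  dirDeriv (tangentFun fun z => e ((chartAt E (e.symm y)).symm z))
    (chartAt E (e.symm y) (e.symm y), tvec e y v) (S.toFun (e.symm y) (tvec e y v))

/-- The quadratic form `Γ_U(y, v)` of a spray in the chart `e`. -/
def Spray.quadForm (S : Spray E M) (e : OpenPartialHomeomorph M E) (y v : E) : E :=
  (S.localRep e y v).2

/-- `S` is a metric spray of `g`: in every chart,
`g_U(y, Γ_U(y, v), w) = 1/2 d₁g_U(y, v, v; w) - d₁g_U(y, v, w; v)`. -/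
def WeakRiemannianMetric.IsMetricSpray (g : WeakRiemannianMetric E M) (S : Spray E M) : Prop :=
  ∀ e ∈ atlas E M, ∀ y ∈ e.target, ∀ v w : E,
    g.localRep e y (S.quadForm e y v) w =
      (1 / 2 : ℝ) * dirDeriv (fun x => g.localRep e x v v) y w -
        dirDeriv (fun x => g.localRep e x v w) y v

/-- `(M, g)` is a Hesse manifold: it admits a metric spray. -/
def WeakRiemannianMetric.IsHesse (g : WeakRiemannianMetric E M) : Prop :=
  ∃ S : Spray E M, g.IsMetricSpray S

/-- The Hilbert completions of the tangent spaces form a smooth vector bundle over `M` whose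
trivialisations extend bundle trivialisations of `TM`: there are such trivialisations
around all points, and the changes of trivialisations `(x, h) ↦ ext' x (ext x)⁻¹ h` are smooth. -/
def WeakRiemannianMetric.CompletionsFormBundle (g : WeakRiemannianMetric E M) : Prop :=
  ∃ T : M → CompletedTriv g, (∀ p, p ∈ (T p).W) ∧
    ∀ p q, ∀ e ∈ atlas E M,
      BastianiSmoothOn
        (fun z : E × (T p).H => (T q).ext (e.symm z.1) ((T p).extSymm (e.symm z.1) z.2))
        (chartImage e ((T p).W ⊓ (T q).W) ×ˢ univ)

/-- `g` is a robust Riemannian metric. -/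
def WeakRiemannianMetric.IsRobust [IsTopologicalAddGroup E]
    (g : WeakRiemannianMetric E M) : Prop :=
  g.CompletionsFormBundle ∧ g.HasMetricDerivative

end Hesse

end

/-
In a chart, let `Γ(v, w)` be `∇_v w` for the fields with constant coordinates `v` and `w`, where `∇`
is a metric derivative. The Koszul formula expresses `2 g(Γ(v, w), z)` through `d₁g`. The metric may
be weak, but it is nondegenerate, so the formula determines `Γ`. Therefore `Γ` is bilinear and
symmetric, and `∇_X Y` depends on the point values of `X` and `Y` and on the derivative of `Y`
alone. This gives the transformation law of `Γ` under a change of charts, by which `-Γ(v, v)` is the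
quadratic form of a spray. For `w = v` the Koszul formula is the equation of a metric spray.

It remains to see that `Γ(v, v)` is smooth jointly in the base point and `v`. If `∇` preserves
smooth families, apply it to the families of constant fields. If `E` is a Fréchet space, then
`Γ(v, ·)` is continuous by the closed graph theorem, because the Koszul formula exhibits its graph
as closed: its right hand side is continuous, and so are the functions `g(·, z)`. As `Γ(v, w)` is
smooth for fixed `v` and `w`, the Banach-Steinhaus theorem then yields joint continuity, of all
derivatives as well.
-/

section DirDeriv

variable {E : Type*} [AddCommGroup E] [Module ℝ E]
  {F : Type*} [AddCommGroup F] [Module ℝ F] [TopologicalSpace F]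
  {G : Type*} [AddCommGroup G] [Module ℝ G] [TopologicalSpace G]

theorem HasDirDeriv.dirDeriv_eq [T2Space F] {f : E → F} {x v : E} {w : F}
    (h : HasDirDeriv f x v w) : dirDeriv f x v = w :=
  Tendsto.limUnder_eq h

theorem hasDirDeriv_const (c : F) (x v : E) : HasDirDeriv (fun _ : E => c) x v 0 := by
  simpa [HasDirDeriv] using tendsto_const_nhds

theorem HasDirDeriv.prodMk {f : E → F} {g : E → G} {x v : E} {a : F} {b : G}
    (hf : HasDirDeriv f x v a) (hg : HasDirDeriv g x v b) :
    HasDirDeriv (fun y => (f y, g y)) x v (a, b) :=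
  Tendsto.prodMk_nhds hf hg

theorem HasDirDeriv.clm_comp {f : E → F} {x v : E} {w : F} (h : HasDirDeriv f x v w)
    (L : F →L[ℝ] G) : HasDirDeriv (fun y => L (f y)) x v (L w) := by
  refine ((L.continuous.tendsto w).comp h).congr fun t => ?_
  simp

theorem HasDirDeriv.smul [ContinuousConstSMul ℝ F] {f : E → F} {x v : E} {w : F}
    (h : HasDirDeriv f x v w) (r : ℝ) : HasDirDeriv f x (r • v) (r • w) := by
  rcases eq_or_ne r 0 with rfl | hr
  · simpa [HasDirDeriv] using tendsto_const_nhds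
  · have hmul : Tendsto (fun t : ℝ => t * r) (𝓝[≠] 0) (𝓝[≠] 0) := by
      refine tendsto_nhdsWithin_iff.2 ⟨tendsto_nhdsWithin_of_tendsto_nhds ?_, ?_⟩
      · simpa using (continuous_mul_const r).tendsto (0 : ℝ)
      · filter_upwards [self_mem_nhdsWithin] with t ht using mul_ne_zero ht hr
    refine ((h.comp hmul).const_smul r).congr fun t => ?_
    simp only [Function.comp, smul_smul, mul_inv]
    rw [mul_left_comm, mul_inv_cancel₀ hr, mul_one]

theorem HasDirDeriv.comp_add_smul {f : E → F} {x v : E} {s : ℝ} {w : F}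
    (h : HasDirDeriv f (x + s • v) v w) : HasDirDeriv (fun r : ℝ => f (x + r • v)) s 1 w := by
  refine Tendsto.congr (fun t => ?_) h
  simp [add_smul, add_assoc]

theorem exists_dirDeriv_eq_sub {f : E → ℝ} {x v : E} {f' : ℝ → ℝ}
    (h : ∀ s ∈ Icc (0 : ℝ) 1, HasDirDeriv f (x + s • v) v (f' s)) :
    ∃ s ∈ Icc (0 : ℝ) 1, f (x + v) - f x = f' s := by
  have hd : ∀ s ∈ Icc (0 : ℝ) 1, HasDerivAt (fun s : ℝ => f (x + s • v)) (f' s) s := by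
    intro s hs
    rw [hasDerivAt_iff_tendsto_slope_zero]
    simpa [HasDirDeriv] using (h s hs).comp_add_smul
  obtain ⟨s, hs, hslope⟩ := exists_hasDerivAt_eq_slope (fun s : ℝ => f (x + s • v)) f'
    zero_lt_one (fun s hs => (hd s hs).continuousAt.continuousWithinAt)
    (fun s hs => hd s (Ioo_subset_Icc_self hs))
  exact ⟨s, Ioo_subset_Icc_self hs, by simpa using hslope.symm⟩

theorem sub_mem_of_dirDeriv_mem [IsTopologicalAddGroup F] [ContinuousSMul ℝ F]
    [LocallyConvexSpace ℝ F] {f : E → F} {x v : E} {f' : ℝ → F} {C : Set F} (hC : Convex ℝ C)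
    (hcl : IsClosed C) (h : ∀ s ∈ Icc (0 : ℝ) 1, HasDirDeriv f (x + s • v) v (f' s))
    (hf' : ∀ s ∈ Icc (0 : ℝ) 1, f' s ∈ C) : f (x + v) - f x ∈ C := by
  by_contra hn
  obtain ⟨l, r, hl, hr⟩ := geometric_hahn_banach_closed_point hC hcl hn
  obtain ⟨s, hs, heq⟩ := exists_dirDeriv_eq_sub fun s hs => (h s hs).clm_comp l
  rw [map_sub, heq] at hr
  exact (hl _ (hf' s hs)).not_gt hr

end DirDeriv

section DirDerivTopology

variable {E : Type*} [AddCommGroup E] [Module ℝ E] [TopologicalSpace E]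
  {F : Type*} [AddCommGroup F] [Module ℝ F]

theorem tendsto_add_smul_nhdsNE_zero [ContinuousAdd E] [ContinuousSMul ℝ E] (x v : E) :
    Tendsto (fun t : ℝ => x + t • v) (𝓝[≠] 0) (𝓝 x) := by
  have : Continuous fun t : ℝ => x + t • v := by fun_prop
  simpa using tendsto_nhdsWithin_of_tendsto_nhds (this.tendsto 0)

theorem differenceQuotient_eventuallyEq [ContinuousAdd E] [ContinuousSMul ℝ E] {f g : E → F}
    {x : E} (hfg : f =ᶠ[𝓝 x] g) (v : E) :
    (fun t : ℝ => t⁻¹ • (f (x + t • v) - f x)) =ᶠ[𝓝[≠] 0]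
      fun t => t⁻¹ • (g (x + t • v) - g x) := by
  filter_upwards [(tendsto_add_smul_nhdsNE_zero x v).eventually hfg] with t ht
  rw [ht, hfg.eq_of_nhds]

variable [TopologicalSpace F] {G : Type*} [AddCommGroup G] [Module ℝ G]

theorem HasDirDeriv.congr [ContinuousAdd E] [ContinuousSMul ℝ E] {f g : E → F} {x v : E} {w : F}
    (h : HasDirDeriv f x v w) (hfg : f =ᶠ[𝓝 x] g) : HasDirDeriv g x v w :=
  Tendsto.congr' (differenceQuotient_eventuallyEq hfg v) h

theorem dirDeriv_congr [ContinuousAdd E] [ContinuousSMul ℝ E] {f g : E → F} {x : E}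
    (hfg : f =ᶠ[𝓝 x] g) (v : E) : dirDeriv f x v = dirDeriv g x v := by
  rw [dirDeriv, dirDeriv, limUnder, limUnder,
    Filter.map_congr (differenceQuotient_eventuallyEq hfg v)]

theorem hasDirDeriv_clm (L : E →L[ℝ] F) (x v : E) : HasDirDeriv L x v (L v) := by
  refine tendsto_const_nhds.congr' ?_
  filter_upwards [self_mem_nhdsWithin] with t ht
  rw [map_add, map_smul, add_sub_cancel_left, inv_smul_smul₀ ht]

theorem hasDirDeriv_id (x v : E) : HasDirDeriv (fun y : E => y) x v v :=
  hasDirDeriv_clm (ContinuousLinearMap.id ℝ E) x v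

theorem HasDirDeriv.comp_clm [TopologicalSpace G] {f : F → G} {x v : E} {w : G} (L : E →L[ℝ] F)
    (h : HasDirDeriv f (L x) (L v) w) : HasDirDeriv (fun y => f (L y)) x v w := by
  refine Tendsto.congr (fun t => ?_) h
  simp

theorem hasDirDeriv_of_isLinearMap_snd [ContinuousAdd E] [ContinuousSMul ℝ E] [ContinuousAdd F]
    {f : E × G → F} {x h : E} {v k : G} {w : F} (hfv : HasDirDeriv (fun y => f (y, v)) x h w)
    (hfk : ContinuousAt (fun y => f (y, k)) x)
    (hlin : ∀ᶠ y in 𝓝 x, IsLinearMap ℝ fun u => f (y, u)) :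
    HasDirDeriv f (x, v) (h, k) (w + f (x, k)) := by
  have hx := tendsto_add_smul_nhdsNE_zero x h
  refine (Tendsto.add hfv (hfk.tendsto.comp hx)).congr' ?_
  filter_upwards [hx.eventually hlin, self_mem_nhdsWithin] with t hlint ht
  have hadd : f (x + t • h, v + t • k) = f (x + t • h, v) + t • f (x + t • h, k) := by
    rw [hlint.map_add, hlint.map_smul]
  rw [Function.comp_apply, Prod.smul_mk, Prod.mk_add_mk, hadd, add_sub_right_comm, smul_add,
    inv_smul_smul₀ ht]

end DirDerivTopology

section ClosedConvexBasis

variable {F : Type*} [AddCommGroup F] [Module ℝ F] [TopologicalSpace F]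
  [IsTopologicalAddGroup F] [ContinuousSMul ℝ F] [LocallyConvexSpace ℝ F]

theorem exists_isClosed_convex_mem_nhds_subset {a : F} {N : Set F} (hN : N ∈ 𝓝 a) :
    ∃ C ∈ 𝓝 a, IsClosed C ∧ Convex ℝ C ∧ C ⊆ N := by
  obtain ⟨K, ⟨hK, hKcl⟩, hKN⟩ := (closed_nhds_basis a).mem_iff.1 hN
  obtain ⟨C, ⟨hC, hCconv⟩, hCK⟩ := (LocallyConvexSpace.convex_basis (𝕜 := ℝ) a).mem_iff.1 hK
  exact ⟨closure C, mem_of_superset hC subset_closure, isClosed_closure, hCconv.closure,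
    (closure_minimal hCK hKcl).trans hKN⟩

end ClosedConvexBasis

section BastianiC

variable {E : Type*} [AddCommGroup E] [Module ℝ E] [TopologicalSpace E]
  {F : Type*} [AddCommGroup F] [Module ℝ F] [TopologicalSpace F]
  {G : Type*} [AddCommGroup G] [Module ℝ G] [TopologicalSpace G]
  {n : ℕ} {f : E → F} {U : Set E}

theorem BastianiCOn.continuousOn (h : BastianiCOn n f U) : ContinuousOn f U := by
  cases n with
  | zero => exact h
  | succ n => exact h.1

theorem BastianiCOn.hasDirDeriv [T2Space F] (h : BastianiCOn (n + 1) f U) {x : E} (hx : x ∈ U)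
    (v : E) : HasDirDeriv f x v (dirDeriv f x v) := by
  obtain ⟨w, hw⟩ := h.2.1 x hx v
  rwa [hw.dirDeriv_eq]

theorem BastianiCOn.of_succ (h : BastianiCOn (n + 1) f U) : BastianiCOn n f U := by
  induction n generalizing E F with
  | zero => exact h.1
  | succ n ih => exact ⟨h.1, h.2.1, ih h.2.2⟩

theorem BastianiCOn.one_of_succ (h : BastianiCOn (n + 1) f U) : BastianiCOn 1 f U :=
  ⟨h.1, h.2.1, h.2.2.continuousOn⟩

theorem BastianiCOn.mono {V : Set E} (h : BastianiCOn n f U) (hVU : V ⊆ U) :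
    BastianiCOn n f V := by
  induction n generalizing E F with
  | zero => exact ContinuousOn.mono h hVU
  | succ n ih =>
    exact ⟨h.1.mono hVU, fun x hx => h.2.1 x (hVU hx), ih h.2.2 (prod_mono_left hVU)⟩

/-- For a `C¹` map, mean values turn continuity of the derivative into convergence of difference
quotients along moving base points and directions. -/
theorem BastianiCOn.tendsto_slope [IsTopologicalAddGroup E] [ContinuousSMul ℝ E]
    [LocallyConvexSpace ℝ E] [IsTopologicalAddGroup F] [ContinuousSMul ℝ F]
    [LocallyConvexSpace ℝ F] [T2Space F] (h : BastianiCOn 1 f U) (hU : IsOpen U) {x v : E}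
    (hx : x ∈ U) {ι : Type*} {l : Filter ι} {t : ι → ℝ} {y w : ι → E}
    (ht : Tendsto t l (𝓝[≠] 0)) (hy : Tendsto y l (𝓝 x)) (hw : Tendsto w l (𝓝 v)) :
    Tendsto (fun i => (t i)⁻¹ • (f (y i + t i • w i) - f (y i))) l (𝓝 (dirDeriv f x v)) := by
  obtain ⟨ht0, ht_ne⟩ := tendsto_nhdsWithin_iff.1 ht
  intro N hN
  obtain ⟨C, hC, hCcl, hCconv, hCN⟩ := exists_isClosed_convex_mem_nhds_subset hN
  have hO : U ×ˢ univ ∈ 𝓝 (x, v) := (hU.prod isOpen_univ).mem_nhds ⟨hx, trivial⟩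
  obtain ⟨A, hA, B, hB, hAB⟩ := mem_nhds_prod_iff.1
    (inter_mem (h.2.2.continuousOn.continuousAt hO hC) hO)
  obtain ⟨A', ⟨hA', hA'conv⟩, hA'A⟩ := (LocallyConvexSpace.convex_basis (𝕜 := ℝ) x).mem_iff.1 hA
  have hyw : Tendsto (fun i => y i + t i • w i) l (𝓝 x) := by
    simpa using hy.add (ht0.smul hw)
  refine mem_map.2 ?_
  filter_upwards [ht_ne, hy.eventually hA', hyw.eventually hA', hw.eventually hB]
    with i hti hyi hywi hwi
  have hseg : ∀ s ∈ Icc (0 : ℝ) 1, (y i + s • t i • w i, w i) ∈ A ×ˢ B := fun s hs =>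
    ⟨hA'A (hA'conv.add_smul_mem hyi hywi hs), hwi⟩
  have hmem := sub_mem_of_dirDeriv_mem hCconv hCcl (x := y i) (v := t i • w i)
    (fun s hs => ((h.hasDirDeriv (hAB (hseg s hs)).2.1 (w i)).smul (t i)).clm_comp
      ((t i)⁻¹ • ContinuousLinearMap.id ℝ F))
    (fun s hs => by simpa [smul_smul, mul_inv_cancel₀ hti] using (hAB (hseg s hs)).1)
  exact hCN (by simpa [smul_sub] using hmem)

theorem BastianiCOn.hasDirDeriv_comp {D : Type*} [AddCommGroup D] [Module ℝ D]
    [IsTopologicalAddGroup E] [ContinuousSMul ℝ E] [LocallyConvexSpace ℝ E]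
    [IsTopologicalAddGroup F] [ContinuousSMul ℝ F] [LocallyConvexSpace ℝ F] [T2Space F]
    (h : BastianiCOn 1 f U) (hU : IsOpen U) {c : D → E} {x v : D} {a : E} (hx : c x ∈ U)
    (hc : HasDirDeriv c x v a) : HasDirDeriv (fun y => f (c y)) x v (dirDeriv f (c x) a) := by
  refine (h.tendsto_slope hU hx tendsto_id tendsto_const_nhds hc).congr' ?_
  filter_upwards [self_mem_nhdsWithin] with t ht
  simp [smul_inv_smul₀ (show t ≠ 0 from ht)]

section Congr

variable [ContinuousAdd E] [ContinuousSMul ℝ E]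

theorem BastianiCOn.congr {g : E → F} (h : BastianiCOn n f U) (hU : IsOpen U)
    (hfg : EqOn f g U) : BastianiCOn n g U := by
  induction n generalizing E F with
  | zero => exact ContinuousOn.congr h hfg.symm
  | succ n ih =>
    have hev : ∀ x ∈ U, f =ᶠ[𝓝 x] g := fun x hx => mem_of_superset (hU.mem_nhds hx) hfg
    refine ⟨h.1.congr hfg.symm, fun x hx v => (h.2.1 x hx v).imp fun w hw => hw.congr (hev x hx),
      ih h.2.2 (hU.prod isOpen_univ) fun z hz => dirDeriv_congr (hev z.1 hz.1) z.2⟩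

theorem bastianiCOn_succ_of_hasDirDeriv [T2Space F] {f' : E × E → F} (hU : IsOpen U)
    (hf : ContinuousOn f U) (hf' : ∀ x ∈ U, ∀ v, HasDirDeriv f x v (f' (x, v)))
    (h : BastianiCOn n f' (U ×ˢ univ)) : BastianiCOn (n + 1) f U :=
  ⟨hf, fun x hx v => ⟨_, hf' x hx v⟩,
    h.congr (hU.prod isOpen_univ) fun z hz => (hf' z.1 hz.1 z.2).dirDeriv_eq.symm⟩

variable [T2Space F]

theorem bastianiCOn_clm (L : E →L[ℝ] F) (n : ℕ) (U : Set E) : BastianiCOn n L U := by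
  refine BastianiCOn.mono ?_ (subset_univ U)
  induction n generalizing E F with
  | zero => exact L.continuous.continuousOn
  | succ n ih =>
    refine bastianiCOn_succ_of_hasDirDeriv isOpen_univ L.continuous.continuousOn
      (fun x _ v => hasDirDeriv_clm L x v)
      (f' := L.comp (ContinuousLinearMap.snd ℝ E E)) ?_
    rw [univ_prod_univ]
    exact ih (L.comp (ContinuousLinearMap.snd ℝ E E)) univ

theorem bastianiCOn_const (n : ℕ) (c : F) (U : Set E) : BastianiCOn n (fun _ : E => c) U := by
  refine BastianiCOn.mono ?_ (subset_univ U)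
  cases n with
  | zero => exact continuousOn_const
  | succ n =>
    exact bastianiCOn_succ_of_hasDirDeriv isOpen_univ continuousOn_const
      (fun x _ v => hasDirDeriv_const c x v) (bastianiCOn_clm (0 : (E × E) →L[ℝ] F) n _)

theorem BastianiCOn.prodMk [T2Space G] {g : E → G} (hf : BastianiCOn n f U)
    (hg : BastianiCOn n g U) (hU : IsOpen U) : BastianiCOn n (fun x => (f x, g x)) U := by
  induction n generalizing E F G with
  | zero => exact ContinuousOn.prodMk hf hg
  | succ n ih =>
    exact bastianiCOn_succ_of_hasDirDeriv hU (hf.1.prodMk hg.1)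
      (fun x hx v => (hf.hasDirDeriv hx v).prodMk (hg.hasDirDeriv hx v))
      (ih hf.2.2 hg.2.2 (hU.prod isOpen_univ))

end Congr

theorem BastianiCOn.comp_clm [ContinuousAdd E] [ContinuousSMul ℝ E] [T2Space G] {g : F → G}
    {V : Set F} (hg : BastianiCOn n g V) (L : E →L[ℝ] F) (hU : IsOpen U) (hL : MapsTo L U V) :
    BastianiCOn n (fun x => g (L x)) U := by
  induction n generalizing E F with
  | zero => exact ContinuousOn.comp hg L.continuous.continuousOn hL
  | succ n ih =>
    exact bastianiCOn_succ_of_hasDirDeriv hU (hg.1.comp L.continuous.continuousOn hL)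
      (fun x hx v => (hg.hasDirDeriv (hL hx) (L v)).comp_clm L)
      (ih hg.2.2 (L.prodMap L) (hU.prod isOpen_univ) fun z hz => ⟨hL hz.1, trivial⟩)

theorem BastianiCOn.clm_comp [ContinuousAdd E] [ContinuousSMul ℝ E] [T2Space F] [T2Space G]
    (hf : BastianiCOn n f U) (L : F →L[ℝ] G) (hU : IsOpen U) :
    BastianiCOn n (fun x => L (f x)) U := by
  induction n generalizing E with
  | zero => exact L.continuous.comp_continuousOn hf
  | succ n ih =>
    exact bastianiCOn_succ_of_hasDirDeriv hU (L.continuous.comp_continuousOn hf.1)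
      (fun x hx v => (hf.hasDirDeriv hx v).clm_comp L) (ih hf.2.2 (hU.prod isOpen_univ))

theorem BastianiCOn.comp [ContinuousAdd E] [ContinuousSMul ℝ E] [IsTopologicalAddGroup F]
    [ContinuousSMul ℝ F] [LocallyConvexSpace ℝ F] [T2Space F] [IsTopologicalAddGroup G]
    [ContinuousSMul ℝ G] [LocallyConvexSpace ℝ G] [T2Space G] {g : F → G} {V : Set F}
    (hg : BastianiCOn n g V) (hf : BastianiCOn n f U) (hV : IsOpen V) (hU : IsOpen U)
    (hfU : MapsTo f U V) : BastianiCOn n (fun x => g (f x)) U := by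
  induction n generalizing E F G with
  | zero => exact ContinuousOn.comp hg hf hfU
  | succ n ih =>
    have hO := hU.prod (isOpen_univ (X := E))
    have hfst : BastianiCOn n (fun z : E × E => f z.1) (U ×ˢ univ) :=
      hf.of_succ.comp_clm (ContinuousLinearMap.fst ℝ E E) hO fun z hz => hz.1
    exact bastianiCOn_succ_of_hasDirDeriv hU (hg.1.comp hf.1 hfU)
      (fun x hx v => hg.one_of_succ.hasDirDeriv_comp hV (hfU hx) (hf.hasDirDeriv hx v))
      (ih hg.2.2 (hfst.prodMk hf.2.2 hO) (hV.prod isOpen_univ) hO fun z hz =>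
        ⟨hfU hz.1, trivial⟩)

end BastianiC

section BastianiSmooth

variable {E : Type*} [AddCommGroup E] [Module ℝ E] [TopologicalSpace E]
  {F : Type*} [AddCommGroup F] [Module ℝ F] [TopologicalSpace F]
  {G : Type*} [AddCommGroup G] [Module ℝ G] [TopologicalSpace G]
  {f : E → F} {U : Set E} {x : E}

theorem BastianiSmoothOn.continuousOn (hf : BastianiSmoothOn f U) : ContinuousOn f U :=
  hf 0

theorem BastianiSmoothOn.smoothOn_dirDeriv (hf : BastianiSmoothOn f U) :
    BastianiSmoothOn (fun z : E × E => dirDeriv f z.1 z.2) (U ×ˢ univ) :=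
  fun n => (hf (n + 1)).2.2

theorem BastianiSmoothOn.hasDirDeriv [T2Space F] (hf : BastianiSmoothOn f U) (hx : x ∈ U)
    (v : E) : HasDirDeriv f x v (dirDeriv f x v) :=
  (hf 1).hasDirDeriv hx v

variable [IsTopologicalAddGroup E] [ContinuousSMul ℝ E]

theorem BastianiSmoothOn.congr {g : E → F} (hf : BastianiSmoothOn f U) (hU : IsOpen U)
    (hfg : EqOn f g U) : BastianiSmoothOn g U :=
  fun n => (hf n).congr hU hfg

variable [T2Space F]

theorem bastianiSmoothOn_clm (L : E →L[ℝ] F) (U : Set E) : BastianiSmoothOn L U :=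
  fun n => bastianiCOn_clm L n U

theorem bastianiSmoothOn_const (c : F) (U : Set E) : BastianiSmoothOn (fun _ : E => c) U :=
  fun n => bastianiCOn_const n c U

theorem BastianiSmoothOn.prodMk [T2Space G] {g : E → G} (hf : BastianiSmoothOn f U)
    (hg : BastianiSmoothOn g U) (hU : IsOpen U) : BastianiSmoothOn (fun x => (f x, g x)) U :=
  fun n => (hf n).prodMk (hg n) hU

theorem BastianiSmoothOn.comp_clm {g : G → F} {V : Set G} (hg : BastianiSmoothOn g V)
    (L : E →L[ℝ] G) (hU : IsOpen U) (hL : MapsTo L U V) :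
    BastianiSmoothOn (fun x => g (L x)) U :=
  fun n => (hg n).comp_clm L hU hL

theorem BastianiSmoothOn.clm_comp [T2Space G] (hf : BastianiSmoothOn f U) (L : F →L[ℝ] G)
    (hU : IsOpen U) : BastianiSmoothOn (fun x => L (f x)) U :=
  fun n => (hf n).clm_comp L hU

variable [IsTopologicalAddGroup F] [ContinuousSMul ℝ F] [LocallyConvexSpace ℝ F]
  [IsTopologicalAddGroup G] [ContinuousSMul ℝ G] [LocallyConvexSpace ℝ G] [T2Space G]

theorem BastianiSmoothOn.comp {g : F → G} {V : Set F} (hg : BastianiSmoothOn g V)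
    (hf : BastianiSmoothOn f U) (hV : IsOpen V) (hU : IsOpen U) (hfU : MapsTo f U V) :
    BastianiSmoothOn (fun x => g (f x)) U :=
  fun n => (hg n).comp (hf n) hV hU hfU

end BastianiSmooth

section Linearity

variable {E : Type*} [AddCommGroup E] [Module ℝ E] [TopologicalSpace E]
  [IsTopologicalAddGroup E] [ContinuousSMul ℝ E] [LocallyConvexSpace ℝ E]
  {F : Type*} [AddCommGroup F] [Module ℝ F] [TopologicalSpace F]
  [IsTopologicalAddGroup F] [ContinuousSMul ℝ F] [LocallyConvexSpace ℝ F] [T2Space F]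
  {f : E → F} {U : Set E} {x : E}

theorem BastianiSmoothOn.hasDirDeriv_comp {D : Type*} [AddCommGroup D] [Module ℝ D]
    (hf : BastianiSmoothOn f U) (hU : IsOpen U) {c : D → E} {y v : D} {a : E} (hy : c y ∈ U)
    (hc : HasDirDeriv c y v a) : HasDirDeriv (fun z => f (c z)) y v (dirDeriv f (c y) a) :=
  (hf 1).hasDirDeriv_comp hU hy hc

theorem BastianiSmoothOn.isLinearMap_dirDeriv (hf : BastianiSmoothOn f U) (hU : IsOpen U)
    (hx : x ∈ U) : IsLinearMap ℝ (dirDeriv f x) where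
  map_add v w := by
    have hw := (hf 1).tendsto_slope hU hx tendsto_id (tendsto_add_smul_nhdsNE_zero x v)
      (tendsto_const_nhds (x := w))
    refine HasDirDeriv.dirDeriv_eq ((Tendsto.add (hf.hasDirDeriv hx v) hw).congr fun t => ?_)
    rw [id, ← smul_add, smul_add t v w, ← add_assoc, sub_add_sub_cancel']
  map_smul r v := ((hf.hasDirDeriv hx v).smul r).dirDeriv_eq

variable [T2Space E]

theorem BastianiSmoothOn.smoothOn_dirDeriv_apply (hf : BastianiSmoothOn f U) (hU : IsOpen U)
    (v : E) : BastianiSmoothOn (fun y => dirDeriv f y v) U :=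
  hf.smoothOn_dirDeriv.comp (f := fun y => (y, v))
    ((bastianiSmoothOn_clm (ContinuousLinearMap.id ℝ E) U).prodMk (bastianiSmoothOn_const v U) hU)
    (hU.prod isOpen_univ) hU fun _ hy => ⟨hy, trivial⟩

theorem BastianiSmoothOn.hasDirDeriv_dirDeriv (hf : BastianiSmoothOn f U) (hU : IsOpen U)
    (hx : x ∈ U) (v h k : E) :
    HasDirDeriv (fun z : E × E => dirDeriv f z.1 z.2) (x, v) (h, k)
      (dirDeriv (fun y => dirDeriv f y v) x h + dirDeriv f x k) := by
  refine hasDirDeriv_of_isLinearMap_snd ((hf.smoothOn_dirDeriv_apply hU v).hasDirDeriv hx h)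
    ((hf.smoothOn_dirDeriv_apply hU k).continuousOn.continuousAt (hU.mem_nhds hx)) ?_
  filter_upwards [hU.mem_nhds hx] with y hy using hf.isLinearMap_dirDeriv hU hy

theorem BastianiSmoothOn.hasDirDeriv_tangentFun (hf : BastianiSmoothOn f U) (hU : IsOpen U)
    (hx : x ∈ U) (v h k : E) :
    HasDirDeriv (tangentFun f) (x, v) (h, k)
      (dirDeriv f x h, dirDeriv (fun y => dirDeriv f y v) x h + dirDeriv f x k) := by
  have hfst : HasDirDeriv (fun z : E × E => f z.1) (x, v) (h, k) (dirDeriv f x h) :=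
    HasDirDeriv.comp_clm (ContinuousLinearMap.fst ℝ E E) (hf.hasDirDeriv hx h)
  exact hfst.prodMk (hf.hasDirDeriv_dirDeriv hU hx v h k)

end Linearity

section SecondDerivative

variable {E : Type*} [AddCommGroup E] [Module ℝ E] [TopologicalSpace E]
  [IsTopologicalAddGroup E] [ContinuousSMul ℝ E] [LocallyConvexSpace ℝ E]
  {U : Set E} {x : E}

theorem eventually_segment_mem (hU : U ∈ 𝓝 x) (v w : E) :
    ∀ᶠ t : ℝ in 𝓝[≠] 0, ∀ s ∈ Icc (0 : ℝ) 1, x + s • t • v ∈ U ∧ x + s • t • v + t • w ∈ U := by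
  obtain ⟨A, ⟨hA, hAconv⟩, hAU⟩ := (LocallyConvexSpace.convex_basis (𝕜 := ℝ) x).mem_iff.1 hU
  filter_upwards [(tendsto_add_smul_nhdsNE_zero x v).eventually hA,
    (tendsto_add_smul_nhdsNE_zero x w).eventually hA,
    (tendsto_add_smul_nhdsNE_zero x (w + v)).eventually hA] with t hv hw hwv s hs
  rw [smul_add, ← add_assoc] at hwv
  rw [add_right_comm]
  exact ⟨hAU (hAconv.add_smul_mem (mem_of_mem_nhds hA) hv hs),
    hAU (hAconv.add_smul_mem hw hwv hs)⟩

theorem BastianiSmoothOn.eventually_second_difference_eq {f : E → ℝ} (hf : BastianiSmoothOn f U)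
    (hU : IsOpen U) (hx : x ∈ U) (v w : E) :
    ∀ᶠ t : ℝ in 𝓝[≠] 0, ∃ s ∈ Icc (0 : ℝ) 1,
      (f (x + t • v + t • w) - f (x + t • v)) - (f (x + t • w) - f x) =
        t * (dirDeriv f (x + s • t • v + t • w) v - dirDeriv f (x + s • t • v) v) := by
  filter_upwards [eventually_segment_mem (hU.mem_nhds hx) v w] with t ht
  refine (exists_dirDeriv_eq_sub (f := fun y => f (y + t • w) - f y) fun s hs => ?_)
  have hshift : HasDirDeriv (fun y => f (y + t • w)) (x + s • t • v) v
      (dirDeriv f (x + s • t • v + t • w) v) :=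
    Tendsto.congr (fun r => by rw [add_right_comm]) (hf.hasDirDeriv (ht s hs).2 v)
  exact ((hshift.prodMk (hf.hasDirDeriv (ht s hs).1 v)).clm_comp
    (ContinuousLinearMap.fst ℝ ℝ ℝ - ContinuousLinearMap.snd ℝ ℝ ℝ)).smul t

variable [T2Space E]

theorem BastianiSmoothOn.tendsto_second_difference {f : E → ℝ} (hf : BastianiSmoothOn f U)
    (hU : IsOpen U) (hx : x ∈ U) (v w : E) :
    Tendsto (fun t : ℝ => t⁻¹ * (t⁻¹ * ((f (x + t • v + t • w) - f (x + t • v)) -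
      (f (x + t • w) - f x)))) (𝓝[≠] 0) (𝓝 (dirDeriv (fun y => dirDeriv f y v) x w)) := by
  obtain ⟨s, hs⟩ := (hf.eventually_second_difference_eq hU hx v w).choice
  have hst : Tendsto (fun t : ℝ => s t * t) (𝓝[≠] 0) (𝓝 0) := by
    refine squeeze_zero_norm' ?_ (tendsto_norm_zero.mono_left nhdsWithin_le_nhds)
    filter_upwards [hs] with t ht
    rw [norm_mul]
    exact mul_le_of_le_one_left (norm_nonneg t) (abs_le.2 ⟨by linarith [ht.1.1], ht.1.2⟩)
  have hbase : Tendsto (fun t : ℝ => x + s t • t • v) (𝓝[≠] 0) (𝓝 x) := by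
    simpa [smul_smul] using tendsto_const_nhds.add (hst.smul_const v)
  refine ((hf.smoothOn_dirDeriv_apply hU v 1).tendsto_slope hU hx tendsto_id hbase
    (tendsto_const_nhds (x := w))).congr' ?_
  filter_upwards [hs, self_mem_nhdsWithin] with t ht ht0
  rw [ht.2, inv_mul_cancel_left₀ ht0]
  simp

theorem BastianiSmoothOn.dirDeriv_comm_real {f : E → ℝ} (hf : BastianiSmoothOn f U)
    (hU : IsOpen U) (hx : x ∈ U) (v w : E) :
    dirDeriv (fun y => dirDeriv f y v) x w = dirDeriv (fun y => dirDeriv f y w) x v := by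
  refine tendsto_nhds_unique (hf.tendsto_second_difference hU hx v w)
    ((hf.tendsto_second_difference hU hx w v).congr fun t => ?_)
  rw [add_right_comm x]
  ring

variable {F : Type*} [AddCommGroup F] [Module ℝ F] [TopologicalSpace F]
  [IsTopologicalAddGroup F] [ContinuousSMul ℝ F] [LocallyConvexSpace ℝ F] [T2Space F]

theorem BastianiSmoothOn.dirDeriv_comm {f : E → F} (hf : BastianiSmoothOn f U)
    (hU : IsOpen U) (hx : x ∈ U) (v w : E) :
    dirDeriv (fun y => dirDeriv f y v) x w = dirDeriv (fun y => dirDeriv f y w) x v := by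
  by_contra hne
  obtain ⟨l, hl⟩ := geometric_hahn_banach_point_point hne
  have hcomp : ∀ v w, dirDeriv (fun y => dirDeriv (fun y => l (f y)) y v) x w =
      l (dirDeriv (fun y => dirDeriv f y v) x w) := by
    intro v w
    refine (dirDeriv_congr ?_ w).trans
      (((hf.smoothOn_dirDeriv_apply hU v).hasDirDeriv hx w).clm_comp l).dirDeriv_eq
    filter_upwards [hU.mem_nhds hx] with y hy using
      ((hf.hasDirDeriv hy v).clm_comp l).dirDeriv_eq
  have hcomm := (hf.clm_comp l hU).dirDeriv_comm_real hU hx v w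
  rw [hcomp, hcomp] at hcomm
  exact hl.ne hcomm

end SecondDerivative

section ClosedGraph

open scoped Pointwise in
theorem nonempty_interior_of_isClosed_of_absorbent {E : Type*} [AddCommGroup E] [Module ℝ E]
    [TopologicalSpace E] [ContinuousConstSMul ℝ E] [BaireSpace E] {D : Set E}
    (hD : IsClosed D) (habs : Absorbent ℝ D) : (interior D).Nonempty := by
  have hne (n : ℕ) : (n : ℝ) + 1 ≠ 0 := by positivity
  have hcover : ⋃ n : ℕ, ((n : ℝ) + 1) • D = univ := by
    refine eq_univ_of_forall fun x => mem_iUnion.2 ?_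
    have hn : Tendsto (fun n : ℕ => (n : ℝ) + 1) atTop (Bornology.cobounded ℝ) :=
      (tendsto_atTop_add_const_right _ 1 tendsto_natCast_atTop_atTop).mono_right
        IsOrderBornology.atTop_le_cobounded
    obtain ⟨n, hxn⟩ := (hn.eventually (habs x)).exists
    exact ⟨n, hxn rfl⟩
  obtain ⟨n, hn⟩ := nonempty_interior_of_iUnion_of_closed
    (fun n : ℕ => hD.smul_of_ne_zero (hne n)) hcover
  rw [interior_smul₀ (hne n)] at hn
  exact smul_set_nonempty.1 hn

variable {E : Type*} [AddCommGroup E] [Module ℝ E] [TopologicalSpace E] [IsTopologicalAddGroup E]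
  {F : Type*} [AddCommGroup F] [Module ℝ F]

theorem closure_preimage_mem_nhds_zero [ContinuousConstSMul ℝ E] [BaireSpace E]
    [TopologicalSpace F] [IsTopologicalAddGroup F] [ContinuousSMul ℝ F] (T : E →ₗ[ℝ] F)
    {V : Set F} (hV : V ∈ 𝓝 0) : closure (T ⁻¹' V) ∈ 𝓝 (0 : E) := by
  obtain ⟨W, hW, hWV⟩ : ∃ W ∈ 𝓝 (0 : F), ∀ a ∈ W, ∀ b ∈ W, a - b ∈ V := by
    have hsub : Tendsto (fun p : F × F => p.1 - p.2) (𝓝 0 ×ˢ 𝓝 0) (𝓝 0) := by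
      simpa [nhds_prod_eq] using (continuous_sub (G := F)).tendsto (0, 0)
    obtain ⟨W, hW, hWV⟩ := mem_prod_same_iff.1 (hsub hV)
    exact ⟨W, hW, fun a ha b hb => hWV (mk_mem_prod ha hb)⟩
  have habs : Absorbent ℝ (closure (T ⁻¹' W)) := fun x => by
    refine absorbs_iff_eventually_cobounded_mapsTo.2 ?_
    filter_upwards [absorbs_iff_eventually_cobounded_mapsTo.1
      ((absorbent_nhds_zero (𝕜 := ℝ) hW) (T x))] with c hc y hy
    obtain rfl : y = x := hy
    exact subset_closure (by simpa using hc rfl)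
  obtain ⟨x, hx⟩ := nonempty_interior_of_isClosed_of_absorbent isClosed_closure habs
  have hshift : Tendsto (fun y : E => x + y) (𝓝 0) (𝓝 x) := by
    simpa using (continuous_const_add x).tendsto 0
  filter_upwards [hshift (mem_interior_iff_mem_nhds.1 hx)] with y hy
  have hdiff := map_mem_closure₂ (f := fun a b : E => a - b) (by fun_prop) hy
    (interior_subset hx) (u := T ⁻¹' V) fun a ha b hb => by
      simpa using hWV (T a) ha (T b) hb
  simpa using hdiff

theorem exists_seq_tendsto_zero_of_mem_closure_preimage [FirstCountableTopology E]
    {T : E →ₗ[ℝ] F} {V : ℕ → Set F} (hV : ∀ n, closure (T ⁻¹' V n) ∈ 𝓝 (0 : E)) {x : E}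
    (hx : x ∈ closure (T ⁻¹' V 0)) :
    ∃ r : ℕ → E, r 0 = x ∧ Tendsto r atTop (𝓝 0) ∧ ∀ n, T (r n - r (n + 1)) ∈ V n := by
  obtain ⟨A, hA⟩ := (𝓝 (0 : E)).exists_antitone_basis
  have exists_next (n : ℕ) (x : E) (hx : x ∈ closure (T ⁻¹' V n)) :
      ∃ y ∈ closure (T ⁻¹' V (n + 1)), y ∈ A n ∧ T (x - y) ∈ V n := by
    have hN := inter_mem (hV (n + 1)) (hA.1.mem_of_mem (i := n) trivial)
    have hshift : Tendsto (fun y : E => x - y) (𝓝 x) (𝓝 0) := by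
      simpa using (continuous_sub_left x).tendsto x
    obtain ⟨y, hy, hyV⟩ := mem_closure_iff_nhds.1 hx _ (hshift hN)
    exact ⟨x - y, hy.1, hy.2, by simpa using hyV⟩
  choose! next next_mem next_mem_basis sub_next_mem using exists_next
  let r : ℕ → E := fun n => Nat.rec x next n
  have hr : ∀ n, r n ∈ closure (T ⁻¹' V n) := fun n => by
    induction n with
    | zero => exact hx
    | succ n ih => exact next_mem n _ ih
  refine ⟨r, rfl, ?_, fun n => sub_next_mem n _ (hr n)⟩
  exact (tendsto_add_atTop_iff_nat 1).1 (hA.tendsto fun n => next_mem_basis n _ (hr n))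

theorem sub_mem_of_forall_sub_succ_mem {G : Type*} [AddCommGroup G] {V : ℕ → Set G}
    (h0 : ∀ n, 0 ∈ V n) (hV : ∀ n, ∀ a ∈ V (n + 1), ∀ b ∈ V (n + 1), a + b ∈ V n) {s : ℕ → G}
    (hs : ∀ n, s (n + 1) - s n ∈ V (n + 1)) (n j : ℕ) : s (n + j) - s n ∈ V n := by
  induction j generalizing n with
  | zero => simpa using h0 n
  | succ j ih =>
    have hsplit : s (n + (j + 1)) - s n = (s (n + 1) - s n) + (s (n + 1 + j) - s (n + 1)) := by
      rw [show n + (j + 1) = n + 1 + j by omega]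
      abel
    exact hsplit ▸ hV n _ (hs n) _ (ih (n + 1))

theorem continuous_of_isClosed_graph_of_baireSpace [ContinuousConstSMul ℝ E] [BaireSpace E]
    [FirstCountableTopology E] [UniformSpace F] [IsUniformAddGroup F] [ContinuousSMul ℝ F]
    [FirstCountableTopology F] [CompleteSpace F] (T : E →ₗ[ℝ] F)
    (hT : IsClosed (T.graph : Set (E × F))) : Continuous T := by
  obtain ⟨V, hV, hVadd⟩ := IsTopologicalAddGroup.exists_antitone_basis_nhds_zero F
  have hVmem (n : ℕ) : V n ∈ 𝓝 (0 : F) := hV.1.mem_of_mem trivial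
  refine continuous_of_continuousAt_zero T ?_
  rw [ContinuousAt, map_zero]
  intro N hN
  obtain ⟨C, ⟨hC, hCclosed⟩, hCN⟩ := (closed_nhds_basis (0 : F)).mem_iff.1 hN
  obtain ⟨k, -, hk⟩ := hV.1.mem_iff.1 hC
  refine mem_map.2 (mem_of_superset (closure_preimage_mem_nhds_zero T (hVmem (k + 1)))
    fun x hx => hCN ?_)
  obtain ⟨r, hr0, hr, hrV⟩ := exists_seq_tendsto_zero_of_mem_closure_preimage
    (V := fun n => V (k + 1 + n)) (fun n => closure_preimage_mem_nhds_zero T (hVmem _)) hx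
  have hdiff (n j : ℕ) : T (x - r (n + j)) - T (x - r n) ∈ V (k + n) := by
    refine sub_mem_of_forall_sub_succ_mem (V := fun n => V (k + n)) (s := fun n => T (x - r n))
      (fun n => mem_of_mem_nhds (hVmem _))
      (fun n a ha b hb => hVadd _ (add_mem_add ha hb)) (fun n => ?_) n j
    simpa [add_right_comm, add_assoc, add_comm 1 n] using hrV n
  have hcauchy : CauchySeq fun n => T (x - r n) := by
    refine (hV.1.uniformity_of_nhds_zero_swapped.cauchySeq_iff').2 fun i _ => ⟨i, fun n hn => ?_⟩
    obtain ⟨j, rfl⟩ := Nat.exists_eq_add_of_le hn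
    exact hV.2 (Nat.le_add_left i k) (hdiff i j)
  obtain ⟨y, hy⟩ := cauchySeq_tendsto_of_complete hcauchy
  have hgraph : (x, y) ∈ (T.graph : Set (E × F)) := by
    have hlim : Tendsto (fun n => x - r n) atTop (𝓝 x) := by simpa using hr.const_sub x
    exact hT.mem_of_tendsto (hlim.prodMk_nhds hy) (Eventually.of_forall fun n => rfl)
  obtain rfl : y = T x := hgraph
  refine hCclosed.mem_of_tendsto hy (Eventually.of_forall fun n => hk ?_)
  simpa [hr0] using hdiff 0 n

end ClosedGraph

section FrechetSpace

variable {E : Type*} [AddCommGroup E] [TopologicalSpace E] [IsTopologicalAddGroup E]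

theorem IsFrechetSpace.baireSpace (hE : IsFrechetSpace E) : BaireSpace E := by
  obtain ⟨hcount, hcomplete⟩ := hE
  let _ := IsTopologicalAddGroup.rightUniformSpace E
  have : IsUniformAddGroup E := isUniformAddGroup_of_addCommGroup
  have := IsUniformAddGroup.uniformity_countably_generated (α := E)
  infer_instance

theorem IsFrechetSpace.continuous_of_isClosed_graph [Module ℝ E] [ContinuousSMul ℝ E]
    (hE : IsFrechetSpace E) (T : E →ₗ[ℝ] E) (hT : IsClosed (T.graph : Set (E × E))) :
    Continuous T := by
  have := hE.baireSpace
  obtain ⟨hcount, hcomplete⟩ := hE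
  let _ := IsTopologicalAddGroup.rightUniformSpace E
  have : IsUniformAddGroup E := isUniformAddGroup_of_addCommGroup
  exact continuous_of_isClosed_graph_of_baireSpace T hT

end FrechetSpace

section SeparateSmoothness

variable {E : Type u} [AddCommGroup E] [Module ℝ E] [TopologicalSpace E]
  [IsTopologicalAddGroup E] [ContinuousSMul ℝ E] [BarrelledSpace ℝ E]
  {F : Type v} [AddCommGroup F] [Module ℝ F] [TopologicalSpace F]
  [IsTopologicalAddGroup F] [ContinuousSMul ℝ F] [LocallyConvexSpace ℝ F]

theorem tendsto_clm_apply_of_pointwise {L : ℕ → E →L[ℝ] F} {L₀ : E →L[ℝ] F}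
    (hL : ∀ v, Tendsto (fun n => L n v) atTop (𝓝 (L₀ v))) {a : ℕ → E} {v : E}
    (ha : Tendsto a atTop (𝓝 v)) : Tendsto (fun n => L n (a n)) atTop (𝓝 (L₀ v)) := by
  let _ := IsTopologicalAddGroup.rightUniformSpace E
  let _ := IsTopologicalAddGroup.rightUniformSpace F
  have : IsUniformAddGroup E := isUniformAddGroup_of_addCommGroup
  have : IsUniformAddGroup F := isUniformAddGroup_of_addCommGroup
  have hequi : UniformEquicontinuous ((↑) ∘ L : ℕ → E → F) :=
    PolynormableSpace.banach_steinhaus fun v => (hL v).isVonNBounded_range ℝ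
  have hzero : Tendsto (fun n => L n (a n - v)) atTop (𝓝 0) := by
    rw [tendsto_iff_comap, nhds_eq_comap_uniformity, comap_comap, ← tendsto_iff_comap]
    intro W hW
    have hdiff : Tendsto (fun n => a n - v) atTop (𝓝 0) := by simpa using ha.sub_const v
    refine mem_map.2 ?_
    filter_upwards [hdiff.eventually (hequi.equicontinuous 0 W hW)] with n hn
    simpa using hn n
  simpa using hzero.add (hL v)

theorem continuousOn_of_separately [FirstCountableTopology E] {P : Type*} [TopologicalSpace P]
    [FirstCountableTopology P] {f : P × E → F} {U : Set P}
    (hfst : ∀ v, ContinuousOn (fun y => f (y, v)) U)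
    (hsnd : ∀ y ∈ U, ∃ L : E →L[ℝ] F, ∀ v, f (y, v) = L v) : ContinuousOn f (U ×ˢ univ) := by
  choose! L hL using hsnd
  rintro ⟨y, v⟩ ⟨hy, -⟩
  refine tendsto_of_seq_tendsto fun z hz => ?_
  obtain ⟨hz, hzU⟩ := tendsto_nhdsWithin_iff.1 hz
  obtain ⟨hzy, hzv⟩ := (Prod.tendsto_iff _ _).1 hz
  have hpointwise (u : E) : Tendsto (fun n => L (z n).1 u) atTop (𝓝 (L y u)) := by
    have hlim : Tendsto (fun n => f ((z n).1, u)) atTop (𝓝 (f (y, u))) :=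
      (hfst u y hy).tendsto.comp (tendsto_nhdsWithin_iff.2 ⟨hzy, hzU.mono fun n hn => hn.1⟩)
    rw [hL y hy] at hlim
    exact hlim.congr' (hzU.mono fun n hn => hL _ hn.1 u)
  have hlim := tendsto_clm_apply_of_pointwise hpointwise hzv
  rw [← hL y hy] at hlim
  exact hlim.congr' (hzU.mono fun n hn => (hL _ hn.1 _).symm)

variable {P : Type w} [AddCommGroup P] [Module ℝ P] [TopologicalSpace P]
  [IsTopologicalAddGroup P] [ContinuousSMul ℝ P] [T2Space F] {f : P × E → F} {U : Set P}

theorem exists_clm_dirDeriv_of_separately (hU : IsOpen U)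
    (hfst : ∀ v, BastianiSmoothOn (fun y => f (y, v)) U)
    (hsnd : ∀ y ∈ U, ∃ L : E →L[ℝ] F, ∀ v, f (y, v) = L v) {y : P} (hy : y ∈ U) (h : P) :
    ∃ L : E →L[ℝ] F, ∀ v, dirDeriv (fun y => f (y, v)) y h = L v := by
  choose! L hL using hsnd
  let _ := IsTopologicalAddGroup.rightUniformSpace E
  let _ := IsTopologicalAddGroup.rightUniformSpace F
  have : IsUniformAddGroup E := isUniformAddGroup_of_addCommGroup
  have : IsUniformAddGroup F := isUniformAddGroup_of_addCommGroup
  have hlim : Tendsto (fun (t : ℝ) (v : E) => (t⁻¹ • (L (y + t • h) - L y)) v) (𝓝[≠] 0)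
      (𝓝 fun v => dirDeriv (fun y => f (y, v)) y h) := by
    refine tendsto_pi_nhds.2 fun v => Tendsto.congr' ?_ ((hfst v).hasDirDeriv hy h)
    filter_upwards [(tendsto_add_smul_nhdsNE_zero y h).eventually (hU.mem_nhds hy)] with t ht
    simp [hL _ ht, hL _ hy]
  exact ⟨continuousLinearMapOfTendsto _ hlim, fun v => rfl⟩

/- The derivative `(h, k) ↦ ∂₁f(y, v) h + f(y, k)` is a sum of maps which are again smooth in the
first variable and continuous linear in the last one. -/
theorem bastianiSmoothOn_of_separately [FirstCountableTopology E] [FirstCountableTopology P]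
    (hU : IsOpen U) (hfst : ∀ v, BastianiSmoothOn (fun y => f (y, v)) U)
    (hsnd : ∀ y ∈ U, ∃ L : E →L[ℝ] F, ∀ v, f (y, v) = L v) :
    BastianiSmoothOn f (U ×ˢ univ) := by
  intro n
  induction n generalizing P with
  | zero => exact continuousOn_of_separately (fun v => (hfst v).continuousOn) hsnd
  | succ n ih =>
    have hderiv : ∀ x ∈ U ×ˢ univ, ∀ h : P × E,
        HasDirDeriv f x h (dirDeriv (fun y => f (y, x.2)) x.1 h.1 + f (x.1, h.2)) := by
      rintro ⟨y, v⟩ ⟨hy, -⟩ ⟨h, k⟩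
      refine hasDirDeriv_of_isLinearMap_snd ((hfst v).hasDirDeriv hy h)
        ((hfst k).continuousOn.continuousAt (hU.mem_nhds hy)) ?_
      filter_upwards [hU.mem_nhds hy] with y hy
      obtain ⟨L, hL⟩ := hsnd y hy
      exact (funext hL : (fun v => f (y, v)) = L) ▸ L.isLinear
    have hpartial : BastianiCOn n
        (fun z : (P × P) × E => dirDeriv (fun y => f (y, z.2)) z.1.1 z.1.2)
        ((U ×ˢ univ) ×ˢ univ) :=
      ih (hU.prod isOpen_univ) (fun v => (hfst v).smoothOn_dirDeriv)
        fun z hz => exists_clm_dirDeriv_of_separately hU hfst hsnd hz.1 z.2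
    have hO : IsOpen ((U ×ˢ univ) ×ˢ univ : Set ((P × E) × P × E)) :=
      (hU.prod isOpen_univ).prod isOpen_univ
    let base := ContinuousLinearMap.fst ℝ (P × E) (P × E)
    let dir := ContinuousLinearMap.snd ℝ (P × E) (P × E)
    let p := ContinuousLinearMap.fst ℝ P E
    let q := ContinuousLinearMap.snd ℝ P E
    refine bastianiCOn_succ_of_hasDirDeriv
      (f' := fun z => dirDeriv (fun y => f (y, z.1.2)) z.1.1 z.2.1 + f (z.1.1, z.2.2))
      (hU.prod isOpen_univ) (continuousOn_of_separately (fun v => (hfst v).continuousOn) hsnd)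
      hderiv ?_
    exact ((hpartial.comp_clm (((p.comp base).prod (p.comp dir)).prod (q.comp base)) hO
        fun z hz => ⟨⟨hz.1.1, trivial⟩, trivial⟩).prodMk
      ((ih hU hfst hsnd).comp_clm ((p.comp base).prod (q.comp dir)) hO
        fun z hz => ⟨hz.1.1, trivial⟩) hO).clm_comp
      (ContinuousLinearMap.fst ℝ F F + ContinuousLinearMap.snd ℝ F F) hO

end SeparateSmoothness

section ChartImage

variable {E : Type*} [TopologicalSpace E] {M : Type*} [TopologicalSpace M]

/-- The domain of a chart. -/
def chartOpens (e : OpenPartialHomeomorph M E) : Opens M := ⟨e.source, e.open_source⟩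

theorem isOpen_chartImage (e : OpenPartialHomeomorph M E) (U : Opens M) :
    IsOpen (chartImage e U) :=
  e.isOpen_inter_preimage_symm U.isOpen

variable {e f : OpenPartialHomeomorph M E} {U : Opens M} {p : M}

theorem mem_chartImage (he : p ∈ e.source) (hU : p ∈ U) : e p ∈ chartImage e U :=
  ⟨e.map_source he, by rwa [mem_preimage, e.left_inv he]⟩

theorem comp_chartChange_eventuallyEq {α : Type*} (hpe : p ∈ e.source) (hpf : p ∈ f.source)
    (φ : M → α) : (fun x => φ (e.symm (e (f.symm x)))) =ᶠ[𝓝 (f p)] fun x => φ (f.symm x) := by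
  filter_upwards [(isOpen_chartImage f (chartOpens e)).mem_nhds (mem_chartImage hpf hpe)]
    with x hx
  rw [e.left_inv hx.2]

end ChartImage

section ChartChange

variable {E : Type u} [AddCommGroup E] [Module ℝ E] [TopologicalSpace E]
  {M : Type w} [TopologicalSpace M]

/-- The change of coordinates of tangent vectors at `p` from the chart `e` to the chart `f`. -/
noncomputable def tangentChange (e f : OpenPartialHomeomorph M E) (p : M) (v : E) : E :=
  dirDeriv (fun y => f (e.symm y)) (e p) v

variable {e f h : OpenPartialHomeomorph M E} {U : Opens M} {p : M}

theorem tangentChange_self [ContinuousAdd E] [ContinuousSMul ℝ E] [T2Space E]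
    (hpe : p ∈ e.source) (v : E) : tangentChange e e p v = v := by
  have hid : (fun y => e (e.symm y)) =ᶠ[𝓝 (e p)] fun y => y := by
    filter_upwards [e.open_target.mem_nhds (e.map_source hpe)] with y hy using e.right_inv hy
  rw [tangentChange, dirDeriv_congr hid]
  exact (hasDirDeriv_id _ v).dirDeriv_eq

variable [ChartedSpace E M] [BastianiManifold E M]

theorem bastianiSmoothOn_chartChange (he : e ∈ atlas E M) (hf : f ∈ atlas E M) :
    BastianiSmoothOn (fun y => f (e.symm y)) (chartImage e (chartOpens f)) :=
  BastianiManifold.smooth_change e he f hf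

theorem hasDirDeriv_chartChange [T2Space E] (he : e ∈ atlas E M) (hf : f ∈ atlas E M)
    (hpe : p ∈ e.source) (hpf : p ∈ f.source) (v : E) :
    HasDirDeriv (fun y => f (e.symm y)) (e p) v (tangentChange e f p v) :=
  (bastianiSmoothOn_chartChange he hf).hasDirDeriv (mem_chartImage hpe hpf) v

variable [IsTopologicalAddGroup E] [ContinuousSMul ℝ E] [LocallyConvexSpace ℝ E] [T2Space E]

theorem isLinearMap_tangentChange (he : e ∈ atlas E M) (hf : f ∈ atlas E M) (hpe : p ∈ e.source)
    (hpf : p ∈ f.source) : IsLinearMap ℝ (tangentChange e f p) :=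
  (bastianiSmoothOn_chartChange he hf).isLinearMap_dirDeriv
    (isOpen_chartImage e (chartOpens f)) (mem_chartImage hpe hpf)

theorem dirDeriv_chartChange_comm (he : e ∈ atlas E M) (hf : f ∈ atlas E M) (hpe : p ∈ e.source)
    (hpf : p ∈ f.source) (v w : E) :
    dirDeriv (fun y => dirDeriv (fun y => f (e.symm y)) y v) (e p) w =
      dirDeriv (fun y => dirDeriv (fun y => f (e.symm y)) y w) (e p) v :=
  (bastianiSmoothOn_chartChange he hf).dirDeriv_comm
    (isOpen_chartImage e (chartOpens f)) (mem_chartImage hpe hpf) v w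

theorem dirDeriv_comp_chartChange {F : Type v} [AddCommGroup F] [Module ℝ F] [TopologicalSpace F]
    [IsTopologicalAddGroup F] [ContinuousSMul ℝ F] [LocallyConvexSpace ℝ F] [T2Space F]
    (he : e ∈ atlas E M) (hf : f ∈ atlas E M) {φ : E → F}
    (hφ : BastianiSmoothOn φ (chartImage f U)) (hpU : p ∈ U) (hpe : p ∈ e.source)
    (hpf : p ∈ f.source) (v : E) :
    dirDeriv (fun y => φ (f (e.symm y))) (e p) v = dirDeriv φ (f p) (tangentChange e f p v) := by
  have hmem : f (e.symm (e p)) ∈ chartImage f U := by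
    rw [e.left_inv hpe]
    exact mem_chartImage hpf hpU
  have hcomp := (hφ.hasDirDeriv_comp (isOpen_chartImage f U) (c := fun y => f (e.symm y)) hmem
    (hasDirDeriv_chartChange he hf hpe hpf v)).dirDeriv_eq
  rwa [e.left_inv hpe] at hcomp

theorem tangentChange_tangentChange (he : e ∈ atlas E M) (hf : f ∈ atlas E M)
    (hh : h ∈ atlas E M) (hpe : p ∈ e.source) (hpf : p ∈ f.source) (hph : p ∈ h.source) (v : E) :
    tangentChange f h p (tangentChange e f p v) = tangentChange e h p v := by
  rw [tangentChange, ← dirDeriv_comp_chartChange he hf (bastianiSmoothOn_chartChange hf hh)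
    hph hpe hpf, dirDeriv_congr (comp_chartChange_eventuallyEq hpf hpe h), tangentChange]

theorem tangentChange_inv (he : e ∈ atlas E M) (hf : f ∈ atlas E M) (hpe : p ∈ e.source)
    (hpf : p ∈ f.source) (v : E) : tangentChange f e p (tangentChange e f p v) = v := by
  rw [tangentChange_tangentChange he hf he hpe hpf hpe, tangentChange_self hpe]

theorem derivAlong_eq (he : e ∈ atlas E M) {φ : M → ℝ}
    (hφ : BastianiSmoothOn (fun y => φ (e.symm y)) (chartImage e U)) (X : ∀ p : M, TVec E p)
    (hpU : p ∈ U) (hpe : p ∈ e.source) :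
    derivAlong X φ p = dirDeriv (fun y => φ (e.symm y)) (e p) (localRep e X (e p)) := by
  have hpc := mem_chart_source E p
  rw [derivAlong, ← dirDeriv_congr (comp_chartChange_eventuallyEq hpe hpc φ),
    dirDeriv_comp_chartChange (chart_mem_atlas E p) he hφ hpU hpc hpe, localRep, tcoord,
    e.left_inv hpe]
  rfl

end ChartChange

section VectorField

variable {E : Type u} [AddCommGroup E] [Module ℝ E] [TopologicalSpace E]
  {M : Type w} [TopologicalSpace M] [ChartedSpace E M]
  {e f : OpenPartialHomeomorph M E} {U : Opens M} {p : M} {X Y : ∀ p : M, TVec E p}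

theorem localRep_apply (hpe : p ∈ e.source) (X : ∀ p : M, TVec E p) :
    localRep e X (e p) = tangentChange (chartAt E p) e p (X p) := by
  rw [localRep, e.left_inv hpe]
  rfl

/-- The vector field on the domain of the chart `e` with constant coordinates `v`. -/
noncomputable def constVF (e : OpenPartialHomeomorph M E) (v : E) (p : M) : TVec E p :=
  tangentChange e (chartAt E p) p v

theorem tvec_eq_constVF {y : E} (hy : y ∈ e.target) (v : E) :
    tvec e y v = constVF e v (e.symm y) := by
  rw [constVF, tangentChange, e.right_inv hy]
  rfl

variable [IsTopologicalAddGroup E] [ContinuousSMul ℝ E] [LocallyConvexSpace ℝ E] [T2Space E]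

theorem IsSmoothFamily.isSmoothVF {X : E → ∀ p : M, TVec E p} (hX : IsSmoothFamily U X) (v : E) :
    IsSmoothVF U (X v) := by
  intro f hf
  have hO := isOpen_chartImage f U
  exact (hX f hf).comp (f := fun x => (v, x)) ((bastianiSmoothOn_const v _).prodMk
    (bastianiSmoothOn_clm (ContinuousLinearMap.id ℝ E) _) hO) (isOpen_univ.prod hO) hO
    fun x hx => ⟨trivial, hx⟩

variable [BastianiManifold E M]

theorem isLinearMap_constVF (he : e ∈ atlas E M) (hpe : p ∈ e.source) :
    IsLinearMap ℝ fun v => constVF e v p :=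
  isLinearMap_tangentChange he (chart_mem_atlas E p) hpe (mem_chart_source E p)

theorem constVF_localRep (he : e ∈ atlas E M) (hpe : p ∈ e.source) (X : ∀ p : M, TVec E p) :
    constVF e (localRep e X (e p)) p = X p := by
  rw [localRep_apply hpe]
  exact tangentChange_inv (chart_mem_atlas E p) he (mem_chart_source E p) hpe (X p)

theorem localRep_constVF_apply (he : e ∈ atlas E M) (hf : f ∈ atlas E M) (hpe : p ∈ e.source)
    (hpf : p ∈ f.source) (v : E) :
    localRep f (constVF e v) (f p) = tangentChange e f p v := by
  rw [localRep_apply hpf]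
  exact tangentChange_tangentChange he (chart_mem_atlas E p) hf hpe (mem_chart_source E p) hpf v

theorem localRep_constVF (he : e ∈ atlas E M) (v : E) {y : E} (hy : y ∈ e.target) :
    localRep e (constVF e v) y = v := by
  have hpe := e.map_target hy
  rw [← e.right_inv hy, localRep_constVF_apply he he hpe hpe, tangentChange_self hpe]

theorem localRep_change (he : e ∈ atlas E M) (hf : f ∈ atlas E M) (hpe : p ∈ e.source)
    (hpf : p ∈ f.source) (X : ∀ p : M, TVec E p) :
    localRep f X (f p) = tangentChange e f p (localRep e X (e p)) := by
  rw [localRep_apply hpf, localRep_apply hpe]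
  exact (tangentChange_tangentChange (chart_mem_atlas E p) he hf (mem_chart_source E p) hpe hpf
    (X p)).symm

theorem dirDeriv_localRep_constVF (he : e ∈ atlas E M) (v : E) {y : E} (hy : y ∈ e.target)
    (k : E) : dirDeriv (localRep e (constVF e v)) y k = 0 := by
  have hconst : localRep e (constVF e v) =ᶠ[𝓝 y] fun _ => v := by
    filter_upwards [e.open_target.mem_nhds hy] with x hx using localRep_constVF he v hx
  rw [dirDeriv_congr hconst]
  exact (hasDirDeriv_const v y k).dirDeriv_eq

theorem isSmoothFamily_constVF (he : e ∈ atlas E M) (hU : U ≤ chartOpens e) :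
    IsSmoothFamily U (constVF e) := by
  intro f hf
  have hO : IsOpen ((univ : Set E) ×ˢ chartImage f U) := isOpen_univ.prod (isOpen_chartImage f U)
  have hchange : BastianiSmoothOn (fun z : E × E => (e (f.symm z.2), z.1))
      (univ ×ˢ chartImage f U) :=
    ((bastianiSmoothOn_chartChange hf he).comp_clm (ContinuousLinearMap.snd ℝ E E) hO
      (fun z hz => ⟨hz.2.1, hU hz.2.2⟩)).prodMk
      (bastianiSmoothOn_clm (ContinuousLinearMap.fst ℝ E E) _) hO
  refine ((bastianiSmoothOn_chartChange he hf).smoothOn_dirDeriv.comp hchange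
    ((isOpen_chartImage e (chartOpens f)).prod isOpen_univ) hO (fun z hz =>
      ⟨mem_chartImage (hU hz.2.2) (f.map_target hz.2.1), trivial⟩)).congr hO ?_
  rintro ⟨v, x⟩ ⟨-, hx, hxU⟩
  have hrep := localRep_constVF_apply he hf (hU hxU) (f.map_target hx) v
  rw [f.right_inv hx] at hrep
  exact hrep.symm

theorem isSmoothVF_constVF (he : e ∈ atlas E M) (hU : U ≤ chartOpens e) (v : E) :
    IsSmoothVF U (constVF e v) :=
  (isSmoothFamily_constVF he hU).isSmoothVF v

theorem dirDeriv_localRep_change (he : e ∈ atlas E M) (hf : f ∈ atlas E M) (hX : IsSmoothVF U X)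
    (hpU : p ∈ U) (hpe : p ∈ e.source) (hpf : p ∈ f.source) (k : E) :
    dirDeriv (localRep f X) (f p) (tangentChange e f p k) =
      dirDeriv (fun y => dirDeriv (fun y => f (e.symm y)) y (localRep e X (e p))) (e p) k +
        tangentChange e f p (dirDeriv (localRep e X) (e p) k) := by
  have hchange := bastianiSmoothOn_chartChange he hf
  have hO := isOpen_chartImage e (chartOpens f)
  have hp : e p ∈ chartImage e (chartOpens f) := mem_chartImage hpe hpf
  have hrep : (fun y => localRep f X (f (e.symm y))) =ᶠ[𝓝 (e p)]
      fun y => dirDeriv (fun y => f (e.symm y)) y (localRep e X y) := by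
    filter_upwards [hO.mem_nhds hp] with y hy
    have hy' := localRep_change he hf (e.map_target hy.1) hy.2 X
    rwa [tangentChange, e.right_inv hy.1] at hy'
  have hcurve : HasDirDeriv (fun y => (y, localRep e X y)) (e p) k
      (k, dirDeriv (localRep e X) (e p) k) :=
    (hasDirDeriv_id _ k).prodMk ((hX e he).hasDirDeriv (mem_chartImage hpe hpU) k)
  have hcomp : HasDirDeriv (fun y => dirDeriv (fun y => f (e.symm y)) y (localRep e X y)) (e p) k
      (dirDeriv (fun z : E × E => dirDeriv (fun y => f (e.symm y)) z.1 z.2)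
        (e p, localRep e X (e p)) (k, dirDeriv (localRep e X) (e p) k)) :=
    hchange.smoothOn_dirDeriv.hasDirDeriv_comp (hO.prod isOpen_univ)
      (c := fun y => (y, localRep e X y)) ⟨hp, trivial⟩ hcurve
  rw [← dirDeriv_comp_chartChange he hf (hX f hf) hpU hpe hpf, dirDeriv_congr hrep,
    hcomp.dirDeriv_eq, (hchange.hasDirDeriv_dirDeriv hO hp _ _ _).dirDeriv_eq, tangentChange]

theorem localRep_lieBracketVF (he : e ∈ atlas E M) (hX : IsSmoothVF U X) (hY : IsSmoothVF U Y)
    (hpU : p ∈ U) (hpe : p ∈ e.source) :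
    localRep e (lieBracketVF X Y) (e p) =
      dirDeriv (localRep e Y) (e p) (localRep e X (e p)) -
        dirDeriv (localRep e X) (e p) (localRep e Y (e p)) := by
  have hc := chart_mem_atlas E p
  have hpc := mem_chart_source E p
  have hXp : tangentChange e (chartAt E p) p (localRep e X (e p)) = X p :=
    constVF_localRep he hpe X
  have hYp : tangentChange e (chartAt E p) p (localRep e Y (e p)) = Y p :=
    constVF_localRep he hpe Y
  rw [localRep_apply hpe, lieBracketVF, ← hXp, ← hYp,
    dirDeriv_localRep_change he hc hX hpU hpe hpc, dirDeriv_localRep_change he hc hY hpU hpe hpc,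
    dirDeriv_chartChange_comm he hc hpe hpc, add_sub_add_left_eq_sub,
    ← (isLinearMap_tangentChange he hc hpe hpc).map_sub, tangentChange_inv he hc hpe hpc]

end VectorField

section Metric

variable {E : Type u} [AddCommGroup E] [Module ℝ E] [TopologicalSpace E]
  {M : Type w} [TopologicalSpace M] [ChartedSpace E M]

/-- The derivative `d₁g_U(y, v, w; a)` of the local representative of `g` in the chart `e`. -/
noncomputable def WeakRiemannianMetric.dOne (g : WeakRiemannianMetric E M)
    (e : OpenPartialHomeomorph M E) (y a v w : E) : ℝ :=
  dirDeriv (fun x => g.localRep e x v w) y a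

/-- The right hand side of the Koszul formula `2 g_U(y, Γ(v, w), z) = …` for the fields with
constant coordinates `v`, `w`, `z` in the chart `e`, whose Lie brackets vanish. -/
noncomputable def WeakRiemannianMetric.koszul (g : WeakRiemannianMetric E M)
    (e : OpenPartialHomeomorph M E) (y v w z : E) : ℝ :=
  g.dOne e y v w z + g.dOne e y w v z - g.dOne e y z v w

variable (g : WeakRiemannianMetric E M) {e : OpenPartialHomeomorph M E} {y : E}

theorem WeakRiemannianMetric.localRep_comm (e : OpenPartialHomeomorph M E) (y v w : E) :
    g.localRep e y v w = g.localRep e y w v :=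
  g.symm _ _ _

theorem WeakRiemannianMetric.dOne_comm (e : OpenPartialHomeomorph M E) (y a v w : E) :
    g.dOne e y a v w = g.dOne e y a w v := by
  simp only [dOne, g.localRep_comm e _ v w]

theorem WeakRiemannianMetric.koszul_comm (e : OpenPartialHomeomorph M E) (y v w z : E) :
    g.koszul e y v w z = g.koszul e y w v z := by
  rw [koszul, koszul, add_comm (g.dOne e y v w z), g.dOne_comm e y z v w]

theorem WeakRiemannianMetric.continuous_localRep_left (he : e ∈ atlas E M) (hy : y ∈ e.target)
    (w : E) : Continuous fun v => g.localRep e y v w :=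
  (g.smooth e he).continuousOn.comp_continuous (f := fun v => (y, v, w)) (by fun_prop)
    fun _ => ⟨hy, trivial⟩

variable [IsTopologicalAddGroup E] [ContinuousSMul ℝ E] [LocallyConvexSpace ℝ E] [T2Space E]

theorem WeakRiemannianMetric.smoothOn_localRep_apply (he : e ∈ atlas E M) (v w : E) :
    BastianiSmoothOn (fun y => g.localRep e y v w) e.target :=
  (g.smooth e he).comp (f := fun y => (y, v, w))
    ((bastianiSmoothOn_clm (ContinuousLinearMap.id ℝ E) _).prodMk
      (bastianiSmoothOn_const (v, w) _) e.open_target)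
    (e.open_target.prod isOpen_univ) e.open_target fun _ hy => ⟨hy, trivial⟩

theorem WeakRiemannianMetric.hasDirDeriv_localRep_apply (he : e ∈ atlas E M) (hy : y ∈ e.target)
    (a v w : E) : HasDirDeriv (fun x => g.localRep e x v w) y a (g.dOne e y a v w) :=
  (g.smoothOn_localRep_apply he v w).hasDirDeriv hy a

theorem WeakRiemannianMetric.isLinearMap_dOne_dir (he : e ∈ atlas E M) (hy : y ∈ e.target)
    (v w : E) : IsLinearMap ℝ fun a => g.dOne e y a v w :=
  (g.smoothOn_localRep_apply he v w).isLinearMap_dirDeriv e.open_target hy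

variable [BastianiManifold E M]

theorem metric_apply_eq_localRep (he : e ∈ atlas E M) {p : M} (hpe : p ∈ e.source)
    (X Y : ∀ p : M, TVec E p) :
    g.val p (X p) (Y p) = g.localRep e (e p) (localRep e X (e p)) (localRep e Y (e p)) := by
  rw [WeakRiemannianMetric.localRep, tvec_eq_constVF (e.map_source hpe),
    tvec_eq_constVF (e.map_source hpe), e.left_inv hpe, constVF_localRep he hpe,
    constVF_localRep he hpe]

theorem WeakRiemannianMetric.isLinearMap_localRep_left (he : e ∈ atlas E M) (hy : y ∈ e.target)
    (w : E) : IsLinearMap ℝ fun v => g.localRep e y v w := by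
  have hconst := isLinearMap_constVF he (e.map_target hy)
  simp only [localRep, tvec_eq_constVF hy]
  exact (((g.val (e.symm y)).flip (constVF e w (e.symm y))).comp (hconst.mk' _)).isLinear

theorem WeakRiemannianMetric.isLinearMap_localRep_right (he : e ∈ atlas E M) (hy : y ∈ e.target)
    (v : E) : IsLinearMap ℝ fun w => g.localRep e y v w := by
  simpa only [g.localRep_comm e y v] using g.isLinearMap_localRep_left he hy v

theorem WeakRiemannianMetric.eq_of_forall_localRep_eq (he : e ∈ atlas E M) (hy : y ∈ e.target)
    {v w : E} (h : ∀ z, g.localRep e y v z = g.localRep e y w z) : v = w := by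
  have hp := e.map_target hy
  have hnull : g.localRep e y (v - w) (v - w) = 0 := by
    rw [(g.isLinearMap_localRep_left he hy _).map_sub, h, sub_self]
  have hzero : constVF e (v - w) (e.symm y) = 0 := by
    rw [← tvec_eq_constVF hy]
    exact g.definite _ _ hnull
  have hinv := tangentChange_inv he (chart_mem_atlas E (e.symm y)) hp (mem_chart_source E _) (v - w)
  rw [← constVF, hzero, (isLinearMap_tangentChange (chart_mem_atlas E (e.symm y)) he
    (mem_chart_source E _) hp).map_zero] at hinv
  exact sub_eq_zero.1 hinv.symm

theorem WeakRiemannianMetric.isLinearMap_dOne_left (he : e ∈ atlas E M) (hy : y ∈ e.target)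
    (a w : E) : IsLinearMap ℝ fun v => g.dOne e y a v w where
  map_add v v' := by
    refine HasDirDeriv.dirDeriv_eq ((((g.hasDirDeriv_localRep_apply he hy a v w).prodMk
      (g.hasDirDeriv_localRep_apply he hy a v' w)).clm_comp
        (ContinuousLinearMap.fst ℝ ℝ ℝ + ContinuousLinearMap.snd ℝ ℝ ℝ)).congr ?_)
    filter_upwards [e.open_target.mem_nhds hy] with x hx using
      ((g.isLinearMap_localRep_left he hx w).map_add v v').symm
  map_smul r v := by
    refine HasDirDeriv.dirDeriv_eq (((g.hasDirDeriv_localRep_apply he hy a v w).clm_comp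
      (r • ContinuousLinearMap.id ℝ ℝ)).congr ?_)
    filter_upwards [e.open_target.mem_nhds hy] with x hx using
      ((g.isLinearMap_localRep_left he hx w).map_smul r v).symm

theorem WeakRiemannianMetric.isLinearMap_koszul (he : e ∈ atlas E M) (hy : y ∈ e.target)
    (v z : E) : IsLinearMap ℝ fun w => g.koszul e y v w z := by
  have hvwz : IsLinearMap ℝ fun w => g.dOne e y v w z := g.isLinearMap_dOne_left he hy v z
  have hwvz : IsLinearMap ℝ fun w => g.dOne e y w v z := g.isLinearMap_dOne_dir he hy v z
  have hzvw : IsLinearMap ℝ fun w => g.dOne e y z v w := by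
    simpa only [g.dOne_comm e y z v] using g.isLinearMap_dOne_left he hy z v
  exact (hvwz.mk' _ + hwvz.mk' _ - hzvw.mk' _).isLinear

theorem WeakRiemannianMetric.hasDirDeriv_localRep (he : e ∈ atlas E M) (hy : y ∈ e.target)
    (v w a b c : E) :
    HasDirDeriv (fun z : E × E × E => g.localRep e z.1 z.2.1 z.2.2) (y, v, w) (a, b, c)
      (g.dOne e y a v w + g.localRep e y b w + g.localRep e y v c) := by
  have hleft : HasDirDeriv (fun z : E × E => g.localRep e z.1 z.2 w) (y, v) (a, b)
      (g.dOne e y a v w + g.localRep e y b w) := by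
    refine hasDirDeriv_of_isLinearMap_snd (g.hasDirDeriv_localRep_apply he hy a v w)
      ((g.smoothOn_localRep_apply he b w).continuousOn.continuousAt (e.open_target.mem_nhds hy)) ?_
    filter_upwards [e.open_target.mem_nhds hy] with x hx using g.isLinearMap_localRep_left he hx w
  have hcont : ContinuousAt (fun z : E × E => g.localRep e z.1 z.2 c) (y, v) :=
    ContinuousAt.comp (g := fun z : E × E × E => g.localRep e z.1 z.2.1 z.2.2)
      (f := fun z : E × E => (z.1, z.2, c))
      ((g.smooth e he).continuousOn.continuousAt
        ((e.open_target.prod isOpen_univ).mem_nhds ⟨hy, trivial⟩)) (by fun_prop)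
  have hpair : HasDirDeriv (fun z : (E × E) × E => g.localRep e z.1.1 z.1.2 z.2) ((y, v), w)
      ((a, b), c) (g.dOne e y a v w + g.localRep e y b w + g.localRep e y v c) := by
    refine hasDirDeriv_of_isLinearMap_snd hleft hcont ?_
    filter_upwards [(e.open_target.prod isOpen_univ).mem_nhds ⟨hy, mem_univ v⟩] with z hz using
      g.isLinearMap_localRep_right he hz.1 z.2
  exact Tendsto.congr (fun t => rfl) hpair

theorem WeakRiemannianMetric.continuous_dOne (he : e ∈ atlas E M) (hy : y ∈ e.target) :
    Continuous fun z : E × E × E => g.dOne e y z.1 z.2.1 z.2.2 := by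
  have hpartial : ∀ z : E × E × E, g.dOne e y z.1 z.2.1 z.2.2 =
      dirDeriv (fun z : E × E × E => g.localRep e z.1 z.2.1 z.2.2) (y, z.2) (z.1, 0) := by
    rintro ⟨a, v, w⟩
    refine ((g.hasDirDeriv_localRep he hy v w a 0 0).dirDeriv_eq.trans ?_).symm
    rw [(g.isLinearMap_localRep_left he hy w).map_zero,
      (g.isLinearMap_localRep_right he hy v).map_zero, add_zero, add_zero]
  simp only [hpartial]
  exact (g.smooth e he).smoothOn_dirDeriv.continuousOn.comp_continuous
    (f := fun z : E × E × E => ((y, z.2), (z.1, 0))) (by fun_prop)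
    fun z => ⟨⟨hy, trivial⟩, trivial⟩

theorem WeakRiemannianMetric.continuous_koszul (he : e ∈ atlas E M) (hy : y ∈ e.target)
    (v z : E) : Continuous fun w => g.koszul e y v w z := by
  have hd := g.continuous_dOne he hy
  have hvwz : Continuous fun w => g.dOne e y v w z :=
    hd.comp (f := fun w => (v, w, z)) (by fun_prop)
  have hwvz : Continuous fun w => g.dOne e y w v z :=
    hd.comp (f := fun w => (w, v, z)) (by fun_prop)
  have hzvw : Continuous fun w => g.dOne e y z v w :=
    hd.comp (f := fun w => (z, v, w)) (by fun_prop)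
  exact (hvwz.add hwvz).sub hzvw

theorem derivAlong_metric_apply (he : e ∈ atlas E M) {U : Opens M} (X : ∀ p : M, TVec E p)
    {Y Z : ∀ p : M, TVec E p} (hY : IsSmoothVF U Y) (hZ : IsSmoothVF U Z) {p : M} (hpU : p ∈ U)
    (hpe : p ∈ e.source) :
    derivAlong X (fun q => g.val q (Y q) (Z q)) p =
      g.dOne e (e p) (localRep e X (e p)) (localRep e Y (e p)) (localRep e Z (e p)) +
        g.localRep e (e p) (dirDeriv (localRep e Y) (e p) (localRep e X (e p)))
          (localRep e Z (e p)) +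
        g.localRep e (e p) (localRep e Y (e p))
          (dirDeriv (localRep e Z) (e p) (localRep e X (e p))) := by
  have hO := isOpen_chartImage e U
  have hGO : IsOpen (e.target ×ˢ (univ : Set (E × E))) := e.open_target.prod isOpen_univ
  have hp := mem_chartImage hpe hpU
  have hrep : EqOn (fun y => g.localRep e y (localRep e Y y) (localRep e Z y))
      (fun y => g.val (e.symm y) (Y (e.symm y)) (Z (e.symm y))) (chartImage e U) := by
    intro y hy
    have hval := metric_apply_eq_localRep g he (e.map_target hy.1) Y Z
    rw [e.right_inv hy.1] at hval
    exact hval.symm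
  have hsmooth : BastianiSmoothOn (fun y => g.localRep e y (localRep e Y y) (localRep e Z y))
      (chartImage e U) :=
    (g.smooth e he).comp (f := fun y => (y, localRep e Y y, localRep e Z y))
      ((bastianiSmoothOn_clm (ContinuousLinearMap.id ℝ E) _).prodMk
        ((hY e he).prodMk (hZ e he) hO) hO) hGO hO fun y hy => ⟨hy.1, trivial⟩
  have hchain := (g.smooth e he).hasDirDeriv_comp hGO
    (c := fun y => (y, localRep e Y y, localRep e Z y)) ⟨hp.1, trivial⟩
    ((hasDirDeriv_id _ (localRep e X (e p))).prodMk
      (((hY e he).hasDirDeriv hp _).prodMk ((hZ e he).hasDirDeriv hp _)))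
  rw [derivAlong_eq he (hsmooth.congr hO hrep) X hpU hpe,
    ← dirDeriv_congr (mem_of_superset (hO.mem_nhds hp) hrep)]
  exact hchain.dirDeriv_eq.trans (g.hasDirDeriv_localRep he hp.1 _ _ _ _ _).dirDeriv_eq

end Metric

section LeviCivita

variable {E : Type u} [AddCommGroup E] [Module ℝ E] [TopologicalSpace E]
  {M : Type w} [TopologicalSpace M] [ChartedSpace E M]

/-- The defining identities of a Levi-Civita derivative of `g`. The condition on smooth families
for model spaces that are not Fréchet is kept apart. -/
structure CovDeriv.IsLeviCivita (D : CovDeriv E M) (g : WeakRiemannianMetric E M) : Prop where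
  torsionFree : D.IsTorsionFree
  compatible : g.IsCompatible D

/-- The difference between `∇_X Y` and the flat derivative `dY(·; X)` of the chart `e`. -/
noncomputable def CovDeriv.christoffelTerm (D : CovDeriv E M) (e : OpenPartialHomeomorph M E)
    (U : Opens M) (X Y : ∀ p : M, TVec E p) (y : E) : E :=
  localRep e (D.nabla U X Y) y - dirDeriv (localRep e Y) y (localRep e X y)

/-- The Christoffel symbol `Γ(y; v, w) = (∇_v w)(y)` of the chart `e`, where `v` and `w` also denote
the fields with these constant coordinates. -/
noncomputable def CovDeriv.christoffel (D : CovDeriv E M) (e : OpenPartialHomeomorph M E)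
    (y v w : E) : E :=
  localRep e (D.nabla (chartOpens e) (constVF e v) (constVF e w)) y

variable [IsTopologicalAddGroup E] [ContinuousSMul ℝ E] [LocallyConvexSpace ℝ E] [T2Space E]
  [BastianiManifold E M] {D : CovDeriv E M} {g : WeakRiemannianMetric E M}
  {e f : OpenPartialHomeomorph M E} {U : Opens M} {p : M} {X Y Z : ∀ p : M, TVec E p} {y : E}

theorem CovDeriv.christoffelTerm_constVF (D : CovDeriv E M) (he : e ∈ atlas E M)
    (hy : y ∈ e.target) (v w : E) :
    D.christoffelTerm e (chartOpens e) (constVF e v) (constVF e w) y = D.christoffel e y v w := by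
  rw [christoffelTerm, dirDeriv_localRep_constVF he w hy, sub_zero, christoffel]

theorem CovDeriv.smoothOn_christoffel (D : CovDeriv E M) (he : e ∈ atlas E M) (v w : E) :
    BastianiSmoothOn (fun y => D.christoffel e y v w) (chartImage e (chartOpens e)) :=
  D.smooth _ _ _ (isSmoothVF_constVF he le_rfl v) (isSmoothVF_constVF he le_rfl w) e he

theorem CovDeriv.IsTorsionFree.christoffelTerm_comm (hD : D.IsTorsionFree) (he : e ∈ atlas E M)
    (hX : IsSmoothVF U X) (hY : IsSmoothVF U Y) (hpU : p ∈ U) (hpe : p ∈ e.source) :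
    D.christoffelTerm e U X Y (e p) = D.christoffelTerm e U Y X (e p) := by
  have htorsion : localRep e (D.nabla U X Y) (e p) - localRep e (D.nabla U Y X) (e p) =
      localRep e (lieBracketVF X Y) (e p) := by
    rw [localRep_apply hpe, localRep_apply hpe, localRep_apply hpe, ← hD U X Y hX hY p hpU,
      (isLinearMap_tangentChange (chart_mem_atlas E p) he (mem_chart_source E p) hpe).map_sub]
  rw [localRep_lieBracketVF he hX hY hpU hpe] at htorsion
  exact sub_eq_sub_iff_sub_eq_sub.2 htorsion

theorem WeakRiemannianMetric.IsCompatible.dOne_eq (hD : g.IsCompatible D) (he : e ∈ atlas E M)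
    (hX : IsSmoothVF U X) (hY : IsSmoothVF U Y) (hZ : IsSmoothVF U Z) (hpU : p ∈ U)
    (hpe : p ∈ e.source) :
    g.dOne e (e p) (_root_.localRep e X (e p)) (_root_.localRep e Y (e p))
        (_root_.localRep e Z (e p)) =
      g.localRep e (e p) (D.christoffelTerm e U X Y (e p)) (_root_.localRep e Z (e p)) +
        g.localRep e (e p) (_root_.localRep e Y (e p)) (D.christoffelTerm e U X Z (e p)) := by
  have hy := e.map_source hpe
  have hcompat := hD U X Y Z hX hY hZ p hpU
  rw [derivAlong_metric_apply g he X hY hZ hpU hpe, metric_apply_eq_localRep g he hpe,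
    metric_apply_eq_localRep g he hpe] at hcompat
  rw [CovDeriv.christoffelTerm, CovDeriv.christoffelTerm,
    (g.isLinearMap_localRep_left he hy _).map_sub, (g.isLinearMap_localRep_right he hy _).map_sub]
  linarith

theorem CovDeriv.IsLeviCivita.two_mul_localRep_christoffelTerm (hD : D.IsLeviCivita g)
    (he : e ∈ atlas E M) (hU : U ≤ chartOpens e) (hX : IsSmoothVF U X) (hY : IsSmoothVF U Y)
    (hpU : p ∈ U) (z : E) :
    2 * g.localRep e (e p) (D.christoffelTerm e U X Y (e p)) z =
      g.koszul e (e p) (localRep e X (e p)) (localRep e Y (e p)) z := by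
  have hpe : p ∈ e.source := hU hpU
  have hZ : IsSmoothVF U (constVF e z) := isSmoothVF_constVF he hU z
  have hXYZ := hD.compatible.dOne_eq he hX hY hZ hpU hpe
  have hYXZ := hD.compatible.dOne_eq he hY hX hZ hpU hpe
  have hZXY := hD.compatible.dOne_eq he hZ hX hY hpU hpe
  rw [hD.torsionFree.christoffelTerm_comm he hX hZ hpU hpe] at hXYZ
  rw [hD.torsionFree.christoffelTerm_comm he hY hX hpU hpe,
    hD.torsionFree.christoffelTerm_comm he hY hZ hpU hpe] at hYXZ
  rw [g.localRep_comm e _ (D.christoffelTerm e U (constVF e z) X (e p))] at hZXY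
  rw [localRep_constVF he z (e.map_source hpe)] at hXYZ hYXZ hZXY
  rw [WeakRiemannianMetric.koszul, hXYZ, hYXZ, hZXY]
  ring

theorem CovDeriv.IsLeviCivita.two_mul_localRep_christoffel (hD : D.IsLeviCivita g)
    (he : e ∈ atlas E M) (hy : y ∈ e.target) (v w z : E) :
    2 * g.localRep e y (D.christoffel e y v w) z = g.koszul e y v w z := by
  have hkoszul := hD.two_mul_localRep_christoffelTerm he le_rfl (isSmoothVF_constVF he le_rfl v)
    (isSmoothVF_constVF he le_rfl w) (e.map_target hy) z
  rwa [e.right_inv hy, D.christoffelTerm_constVF he hy, localRep_constVF he v hy,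
    localRep_constVF he w hy] at hkoszul

theorem CovDeriv.IsLeviCivita.eq_christoffel_iff (hD : D.IsLeviCivita g) (he : e ∈ atlas E M)
    (hy : y ∈ e.target) {v w b : E} :
    b = D.christoffel e y v w ↔ ∀ z, 2 * g.localRep e y b z = g.koszul e y v w z := by
  refine ⟨fun hb z => hb ▸ hD.two_mul_localRep_christoffel he hy v w z, fun hb =>
    g.eq_of_forall_localRep_eq he hy fun z => ?_⟩
  have hz := (hb z).trans (hD.two_mul_localRep_christoffel he hy v w z).symm
  exact mul_left_cancel₀ two_ne_zero hz

theorem CovDeriv.IsLeviCivita.christoffelTerm_eq (hD : D.IsLeviCivita g) (he : e ∈ atlas E M)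
    (hU : U ≤ chartOpens e) (hX : IsSmoothVF U X) (hY : IsSmoothVF U Y) (hpU : p ∈ U) :
    D.christoffelTerm e U X Y (e p) =
      D.christoffel e (e p) (localRep e X (e p)) (localRep e Y (e p)) :=
  (hD.eq_christoffel_iff he (e.map_source (hU hpU))).2
    (hD.two_mul_localRep_christoffelTerm he hU hX hY hpU)

theorem CovDeriv.IsLeviCivita.christoffel_comm (hD : D.IsLeviCivita g) (he : e ∈ atlas E M)
    (hy : y ∈ e.target) (v w : E) : D.christoffel e y v w = D.christoffel e y w v := by
  refine (hD.eq_christoffel_iff he hy).2 fun z => ?_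
  rw [hD.two_mul_localRep_christoffel he hy, g.koszul_comm]

theorem CovDeriv.IsLeviCivita.isLinearMap_christoffel (hD : D.IsLeviCivita g)
    (he : e ∈ atlas E M) (hy : y ∈ e.target) (v : E) : IsLinearMap ℝ (D.christoffel e y v) where
  map_add w w' := by
    refine ((hD.eq_christoffel_iff he hy).2 fun z => ?_).symm
    rw [(g.isLinearMap_localRep_left he hy z).map_add, (g.isLinearMap_koszul he hy v z).map_add,
      mul_add, hD.two_mul_localRep_christoffel he hy, hD.two_mul_localRep_christoffel he hy]
  map_smul r w := by
    refine ((hD.eq_christoffel_iff he hy).2 fun z => ?_).symm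
    rw [(g.isLinearMap_localRep_left he hy z).map_smul, (g.isLinearMap_koszul he hy v z).map_smul,
      mul_smul_comm, hD.two_mul_localRep_christoffel he hy]

theorem CovDeriv.IsLeviCivita.christoffel_smul_smul (hD : D.IsLeviCivita g) (he : e ∈ atlas E M)
    (hy : y ∈ e.target) (r : ℝ) (v : E) :
    D.christoffel e y (r • v) (r • v) = r • r • D.christoffel e y v v := by
  rw [(hD.isLinearMap_christoffel he hy _).map_smul, hD.christoffel_comm he hy,
    (hD.isLinearMap_christoffel he hy _).map_smul]

theorem CovDeriv.IsLeviCivita.tangentChange_christoffel (hD : D.IsLeviCivita g)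
    (he : e ∈ atlas E M) (hf : f ∈ atlas E M) (hpe : p ∈ e.source) (hpf : p ∈ f.source)
    (v w : E) :
    tangentChange e f p (D.christoffel e (e p) v w) =
      D.christoffel f (f p) (tangentChange e f p v) (tangentChange e f p w) +
        dirDeriv (fun y => dirDeriv (fun y => f (e.symm y)) y w) (e p) v := by
  have hpU : p ∈ chartOpens e ⊓ chartOpens f := ⟨hpe, hpf⟩
  have hy := e.map_source hpe
  have hX := isSmoothVF_constVF he (inf_le_left (b := chartOpens f)) v
  have hY := isSmoothVF_constVF he (inf_le_left (b := chartOpens f)) w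
  have hderiv := dirDeriv_localRep_change he hf hY hpU hpe hpf v
  have hterm_e := hD.christoffelTerm_eq he inf_le_left hX hY hpU
  have hterm_f := hD.christoffelTerm_eq hf inf_le_right hX hY hpU
  rw [CovDeriv.christoffelTerm, dirDeriv_localRep_constVF he w hy, sub_zero,
    localRep_constVF he v hy, localRep_constVF he w hy] at hterm_e
  rw [dirDeriv_localRep_constVF he w hy, localRep_constVF he w hy,
    (isLinearMap_tangentChange he hf hpe hpf).map_zero, add_zero] at hderiv
  rw [CovDeriv.christoffelTerm, localRep_constVF_apply he hf hpe hpf,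
    localRep_constVF_apply he hf hpe hpf, localRep_change he hf hpe hpf, hterm_e, hderiv] at hterm_f
  exact sub_eq_iff_eq_add.1 hterm_f

theorem CovDeriv.IsLeviCivita.isClosed_graph_christoffel (hD : D.IsLeviCivita g)
    (he : e ∈ atlas E M) (hy : y ∈ e.target) (v : E) :
    IsClosed {z : E × E | z.2 = D.christoffel e y v z.1} := by
  simp only [hD.eq_christoffel_iff he hy, Set.ofPred_forall]
  refine isClosed_iInter fun z => isClosed_eq ?_ ?_
  · exact continuous_const.mul ((g.continuous_localRep_left he hy z).comp continuous_snd)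
  · exact (g.continuous_koszul he hy v z).comp continuous_fst

theorem CovDeriv.IsLeviCivita.exists_clm_christoffel (hD : D.IsLeviCivita g)
    (hE : IsFrechetSpace E) (he : e ∈ atlas E M) (hy : y ∈ e.target) (v : E) :
    ∃ L : E →L[ℝ] E, ∀ w, D.christoffel e y v w = L w := by
  let T : E →ₗ[ℝ] E := (hD.isLinearMap_christoffel he hy v).mk' _
  have hgraph : IsClosed (T.graph : Set (E × E)) :=
    hD.isClosed_graph_christoffel he hy v
  exact ⟨⟨T, hE.continuous_of_isClosed_graph T hgraph⟩, fun _ => rfl⟩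

theorem CovDeriv.IsLeviCivita.smoothOn_christoffel_of_isFrechetSpace (hD : D.IsLeviCivita g)
    (hE : IsFrechetSpace E) (he : e ∈ atlas E M) :
    BastianiSmoothOn (fun z : (E × E) × E => D.christoffel e z.1.1 z.1.2 z.2)
      ((chartImage e (chartOpens e) ×ˢ univ) ×ˢ univ) := by
  have := hE.1
  have := hE.baireSpace
  have hO := isOpen_chartImage e (chartOpens e)
  have hfst : ∀ w, BastianiSmoothOn (fun z : E × E => D.christoffel e z.1 z.2 w)
      (chartImage e (chartOpens e) ×ˢ univ) := fun w =>
    bastianiSmoothOn_of_separately hO (fun v => D.smoothOn_christoffel he v w) fun y hy => by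
      simpa only [hD.christoffel_comm he hy.1 _ w] using hD.exists_clm_christoffel hE he hy.1 w
  exact bastianiSmoothOn_of_separately (hO.prod isOpen_univ) hfst
    fun z hz => hD.exists_clm_christoffel hE he hz.1.1 z.2

theorem CovDeriv.PreservesSmoothFamilies.smoothOn_christoffel_diag
    (hD : D.PreservesSmoothFamilies) (he : e ∈ atlas E M) :
    BastianiSmoothOn (fun z : E × E => D.christoffel e z.1 z.2 z.2)
      (chartImage e (chartOpens e) ×ˢ univ) := by
  have hconst := isSmoothFamily_constVF he (le_refl (chartOpens e))
  have hnabla := hD _ _ _ hconst hconst e he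
  exact hnabla.comp_clm ((ContinuousLinearMap.snd ℝ E E).prod (ContinuousLinearMap.fst ℝ E E))
    ((isOpen_chartImage e _).prod isOpen_univ) fun z hz => ⟨trivial, hz.1⟩

theorem CovDeriv.IsLeviCivita.smoothOn_christoffel_diag (hD : D.IsLeviCivita g)
    (hF : IsFrechetSpace E ∨ D.PreservesSmoothFamilies) (he : e ∈ atlas E M) :
    BastianiSmoothOn (fun z : E × E => D.christoffel e z.1 z.2 z.2) (e.target ×ˢ univ) := by
  have htarget : chartImage e (chartOpens e) = e.target :=
    inter_eq_left.2 fun _ hy => e.map_target hy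
  rw [← htarget]
  rcases hF with hE | hP
  · exact (hD.smoothOn_christoffel_of_isFrechetSpace hE he).comp_clm
      ((ContinuousLinearMap.id ℝ (E × E)).prod (ContinuousLinearMap.snd ℝ E E))
      ((isOpen_chartImage e _).prod isOpen_univ) fun z hz => ⟨hz, trivial⟩
  · exact hP.smoothOn_christoffel_diag he

end LeviCivita

section MetricSpray

variable {E : Type u} [AddCommGroup E] [Module ℝ E] [TopologicalSpace E]
  {M : Type w} [TopologicalSpace M] [ChartedSpace E M]

/-- The principal part `(v, -Γ(v, v))` of the geodesic spray of a covariant derivative at the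
tangent vector `v`, in the preferred chart of `M` at `p`. -/
noncomputable def CovDeriv.sprayFun (D : CovDeriv E M) (p : M) (v : TVec E p) : E × E :=
  (v, -D.christoffel (chartAt E p) (chartAt E p p) v v)

variable [IsTopologicalAddGroup E] [ContinuousSMul ℝ E] [LocallyConvexSpace ℝ E] [T2Space E]
  [BastianiManifold E M] {D : CovDeriv E M} {g : WeakRiemannianMetric E M}
  {e f : OpenPartialHomeomorph M E} {p : M}

/- The second derivative of the chart change in the second tangent map cancels against the one in
the transformation law of the Christoffel symbols. -/
theorem CovDeriv.IsLeviCivita.dirDeriv_tangentFun_chartChange (hD : D.IsLeviCivita g)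
    (he : e ∈ atlas E M) (hf : f ∈ atlas E M) (hpe : p ∈ e.source) (hpf : p ∈ f.source) (v : E) :
    dirDeriv (tangentFun fun y => f (e.symm y)) (e p, v) (v, -D.christoffel e (e p) v v) =
      (tangentChange e f p v,
        -D.christoffel f (f p) (tangentChange e f p v) (tangentChange e f p v)) := by
  have htangent := ((bastianiSmoothOn_chartChange he hf).hasDirDeriv_tangentFun
    (isOpen_chartImage e (chartOpens f)) (mem_chartImage hpe hpf) v v
    (-D.christoffel e (e p) v v)).dirDeriv_eq
  refine htangent.trans (Prod.ext rfl ?_)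
  change dirDeriv (fun y => dirDeriv (fun y => f (e.symm y)) y v) (e p) v +
    tangentChange e f p (-D.christoffel e (e p) v v) =
    -D.christoffel f (f p) (tangentChange e f p v) (tangentChange e f p v)
  rw [(isLinearMap_tangentChange he hf hpe hpf).map_neg,
    hD.tangentChange_christoffel he hf hpe hpf]
  abel

theorem CovDeriv.IsLeviCivita.dirDeriv_tangentFun_sprayFun (hD : D.IsLeviCivita g)
    (he : e ∈ atlas E M) {y : E} (hy : y ∈ e.target) (v : E) :
    dirDeriv (tangentFun fun z => e ((chartAt E (e.symm y)).symm z))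
      (chartAt E (e.symm y) (e.symm y), tvec e y v) (D.sprayFun (e.symm y) (tvec e y v)) =
      (v, -D.christoffel e y v v) := by
  have hc := chart_mem_atlas E (e.symm y)
  have hpc := mem_chart_source E (e.symm y)
  have hpe := e.map_target hy
  have hinv : tangentChange (chartAt E (e.symm y)) e (e.symm y) (tvec e y v) = v := by
    rw [tvec_eq_constVF hy, constVF, tangentChange_inv he hc hpe hpc]
  rw [CovDeriv.sprayFun, hD.dirDeriv_tangentFun_chartChange hc he hpc hpe, hinv, e.right_inv hy]

/-- The geodesic spray of a Levi-Civita derivative. -/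
noncomputable def CovDeriv.IsLeviCivita.spray (hD : D.IsLeviCivita g)
    (hF : IsFrechetSpace E ∨ D.PreservesSmoothFamilies) : Spray E M where
  toFun := D.sprayFun
  smooth e he := by
    have hO := e.open_target.prod (isOpen_univ (X := E))
    refine ((bastianiSmoothOn_clm (ContinuousLinearMap.snd ℝ E E) _).prodMk
      ((hD.smoothOn_christoffel_diag hF he).clm_comp (-ContinuousLinearMap.id ℝ E) hO) hO).congr
      hO ?_
    rintro ⟨y, v⟩ ⟨hy, -⟩
    exact (hD.dirDeriv_tangentFun_sprayFun he hy v).symm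
  proj _ _ := rfl
  homogeneous c p v := by
    have hquad := hD.christoffel_smul_smul (chart_mem_atlas E p) (mem_chart_target E p) c v
    simp only [CovDeriv.sprayFun, hquad, Prod.smul_mk, smul_neg]

theorem CovDeriv.IsLeviCivita.isMetricSpray_spray (hD : D.IsLeviCivita g)
    (hF : IsFrechetSpace E ∨ D.PreservesSmoothFamilies) : g.IsMetricSpray (hD.spray hF) := by
  intro e he y hy v w
  have hquad : (hD.spray hF).quadForm e y v = -D.christoffel e y v v :=
    congrArg Prod.snd (hD.dirDeriv_tangentFun_sprayFun he hy v)
  have hkoszul := hD.two_mul_localRep_christoffel he hy v v w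
  rw [WeakRiemannianMetric.koszul] at hkoszul
  rw [hquad, (g.isLinearMap_localRep_left he hy w).map_neg]
  change _ = (1 / 2 : ℝ) * g.dOne e y w v v - g.dOne e y v v w
  linarith

end MetricSpray

theorem mainTheorem5_general {E : Type u} [AddCommGroup E] [Module ℝ E] [TopologicalSpace E]
    [IsTopologicalAddGroup E] [ContinuousSMul ℝ E] [LocallyConvexSpace ℝ E] [T2Space E]
    {M : Type w} [TopologicalSpace M] [ChartedSpace E M] [BastianiManifold E M]
    (g : WeakRiemannianMetric E M) (hg : g.HasMetricDerivative) : g.IsHesse := by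
  obtain ⟨D, htorsion, hcompat, hF⟩ := hg
  have hD : D.IsLeviCivita g := ⟨htorsion, hcompat⟩
  exact ⟨hD.spray hF, hD.isMetricSpray_spray hF⟩

theorem mainTheorem5 {E : Type u} [AddCommGroup E] [Module ℝ E] [TopologicalSpace E]
    [IsTopologicalAddGroup E] [ContinuousSMul ℝ E] [LocallyConvexSpace ℝ E] [T2Space E]
    {M : Type w} [TopologicalSpace M] [ChartedSpace E M] [BastianiManifold E M]
    (g : WeakRiemannianMetric E M) (hg : g.IsRobust) : g.IsHesse :=
  mainTheorem5_general g hg.2
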